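/- **Setting.** All systems are qubit registers, $\log$ is to base 2, $F(\rho,\sigma)=\|\sqrt\rho\sqrt\sigma\|_1^2$. Fix a finite, approximately universal gate set $\mathcal G$. A *polynomially generated set of effect operators* is a family $\{\mathbf E_n\}_n$ of sets of effect operators $0\le E\le \mathbb 1$ on $n$ qubits for which there is a polynomial $p$ such that: every $E\in\mathbf E_n$ is implemented (up to relabelling the two outcomes) by adding ancillas $|0\rangle$, applying at most $p(n)$ gates of $\mathcal G$ and measuring one qubit; $E\in\mathbf E_n\Rightarrow \mathbb 1-E\in\mathbf E_n$; $E_1\otimes E_2\in\mathbf E_{n_1+n_2}$ for $E_i\in\mathbf E_{n_i}$ of gate complexity $c_i$ with $c_1+c_2<p(n_1+n_2)$; and $\mathbf E_n$ spans all operators. For a state $\rho$ on $n+n$ qubits $A_1\dots A_nB_1\dots B_n$ let $$E_R(\rho)=\min_{\sigma\in\mathrm{SEP}_n}\ \sup_{E\in\mathbf E_{2n}} D\big(\mathcal M_E(\rho)\,\|\,\mathcal M_E(\sigma)\big),$$ where $\mathrm{SEP}_n$ is the convex hull of the product states $\sigma_A\otimes\sigma_B$, $\mathcal M_E(\rho)=(\mathrm{Tr}[E\rho],\mathrm{Tr}[(\mathbb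 1-E)\rho])$, and $D$ is the relative entropy of probability vectors. A family of LOCC maps is *efficient* if it is implemented by circuits over $\mathcal G$ of polynomial total size: ancillas in $|0\rangle$, rounds in which Alice applies a circuit to her qubits and a communication register $C$, $C$ is measured in the computational basis, Bob does the same, and finally all but the output qubits of each party are traced out; gates, ancilla creations and measurements are counted. Let $\Phi^{\otimes m}=|\Phi_m\rangle\langle\Phi_m|$, $|\Phi_m\rangle=2^{-m/2}\sum_i|i\rangle_A|i\rangle_B$. Let $\{\mathbf E_n\}$ and $\{\mathbf E'_n\}$ be polynomially generated sets of effect operators (possibly the same, possibly with different polynomials); $E_R$ is taken with respect to $\{\mathbf E_n\}$. Let $\varepsilon:\mathbb N_+\to[0,1]$ and let $\rho^n$ be a state on $n+n$ qubits for each $n\ge1$. * $m:\mathbb N\to\mathbb N$ is *achievable* if there is an efficient family of LOCC maps $\Gamma_n$ from $n+n$ to $m(n)+m(n)$ qubits that is test stable, $\Gamma_n^*(\mathbf E'_{2m(n)})\subseteq\mathrm{conv}(\mathbf E_{2n})$, with $1-F(\Gamma_n(\rho^n),\Phi^{\otimes m(n)})\le\varepsilon(n)$ for all $n\ge1$. The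 computational distillable entanglement $E_D(\rho^n)$ is the supremum of $m(n)$ over all achievable $m$. * The computational entanglement cost $E_C(\rho^n)$ is the infimum of $k(n)$ over all $k:\mathbb N\to\mathbb N$ for which there is an efficient family of LOCC maps $\Gamma_n$ from $k(n)+k(n)$ to $n+n$ qubits with $1-F(\rho^n,\Gamma_n(\Phi^{\otimes k(n)}))\le\varepsilon(n)$ for all $n\ge1$ ($+\infty$ if there is none). **Lemma.** Assume that $\Phi^{\otimes m}\in\mathbf E'_{2m}$ for all $m\ge1$, and put, with $h$ the binary entropy, $$g(s,\kappa)=(1+s)\,h\!\left(\frac{s}{1+s}\right)+s\left(\kappa+\log\frac2s\right),\qquad g(0,\kappa)=0 .$$ Then for all $n\ge1$: 1. if $\varepsilon(n)\le\frac12$, then $E_D(\rho^n)\le E_R(\rho^n)+g\big(\sqrt{\varepsilon(n)},n\big)$; 2. with no restriction on $\varepsilon$, every achievable $m$ satisfies $m(n)\le E_R(\rho^n)+g\big(\sqrt{\varepsilon(n)},\max(n,m(n))\big)$; in particular the bound holds with $\kappa=n$ whenever $m(n)\le n$; 3. $E_C(\rho^n)\ge E_R(\rho^n)-g\big(\sqrt{\varepsilon(n)},n\big)$.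 -/

import Mathlib

namespace CompEnt

open scoped MatrixOrder ComplexOrder

noncomputable section

/-! ### Registers of qubits -/

/-- Operators on the register `(ℂ²)^{⊗ V}` whose qubits are labelled by `V`; the computational
basis is indexed by the bit strings `V → Fin 2`. -/
abbrev QMat (V : Type) := Matrix (V → Fin 2) (V → Fin 2) ℂ

/-- Density operators. -/
def IsState {V : Type} [Fintype V] [DecidableEq V] (ρ : QMat V) : Prop :=
  ρ.PosSemidef ∧ ρ.trace = 1

/-- The operator `A ⊗ B` on the register `V ⊕ W`. -/
def tensor {V W : Type} (A : QMat V) (B : QMat W) : QMat (V ⊕ W) :=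
  fun x y => A (fun v => x (Sum.inl v)) (fun v => y (Sum.inl v)) *
    B (fun w => x (Sum.inr w)) (fun w => y (Sum.inr w))

/-- Renaming of the qubits of a register. -/
def relabel {V W : Type} (e : V ≃ W) (A : QMat V) : QMat W :=
  fun x y => A (fun v => x (e v)) (fun v => y (e v))

/-- The state `ρ` on the sub-register `V` of `W` (given by `e`), all other qubits being `|0⟩`. -/
def addAncillas {V W : Type} (e : V ↪ W) (ρ : QMat V) : QMat W :=
  open Classical in
  fun x y => if ∀ w, w ∉ Set.range e → x w = 0 ∧ y w = 0
    then ρ (fun v => x (e v)) (fun v => y (e v)) else 0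

/-- The partial trace over all the qubits of `W` outside the sub-register `V`. -/
def reduceTo {V W : Type} [Fintype W] [DecidableEq W] (e : V ↪ W) (ρ : QMat W) : QMat V :=
  open Classical in
  fun x y => ∑ z : W → Fin 2, ∑ z' : W → Fin 2,
    if (∀ v, z (e v) = x v) ∧ (∀ v, z' (e v) = y v) ∧ (∀ w, w ∉ Set.range e → z w = z' w)
    then ρ z z' else 0

/-- Measurement of the sub-register `V` in the computational basis (the qubits are kept, in the
post-measurement state, averaged over the outcomes). -/
def measureReg {V W : Type} (e : V ↪ W) (ρ : QMat W) : QMat W :=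
  open Classical in
  fun x y => if ∀ v, x (e v) = y (e v) then ρ x y else 0

/-! ### Gates and circuits -/

/-- A finite set of gates; the gate `g` is a unitary on `arity g` qubits. -/
structure GateSet where
  ι : Type
  finite : Finite ι
  arity : ι → ℕ
  mat : ∀ g, QMat (Fin (arity g))
  unitary : ∀ g, mat g ∈ Matrix.unitaryGroup (Fin (arity g) → Fin 2) ℂ

/-- The gate `U` applied to the (distinct, ordered) qubits `e 0, e 1, …` of the register `W`. -/
def applyGate {W : Type} {k : ℕ} (U : QMat (Fin k)) (e : Fin k ↪ W) : QMat W :=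
  open Classical in
  fun x y => if ∀ w, w ∉ Set.range e → x w = y w
    then U (fun i => x (e i)) (fun i => y (e i)) else 0

/-- A circuit on the register `W`: a list of gates with the qubits they act on, in the order of
application. Its number of gates is the length of the list. -/
abbrev Circuit (G : GateSet) (W : Type) := List (Σ g : G.ι, (Fin (G.arity g) ↪ W))

/-- The unitary of a circuit. -/
def Circuit.toMat {G : GateSet} {W : Type} [Fintype W] [DecidableEq W] : Circuit G W → QMat W
  | [] => 1
  | g :: C => Circuit.toMat C * applyGate (G.mat g.1) g.2

/-- A circuit on the register `V`, regarded as one on a larger register. -/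
def Circuit.embed {G : GateSet} {V W : Type} (e : V ↪ W) (C : Circuit G V) : Circuit G W :=
  C.map fun g => ⟨g.1, g.2.trans e⟩

/-- Approximate universality: on all large enough registers, every unitary is approximated, up to
a global phase and to every accuracy, by circuits. -/
def GateSet.IsApproxUniversal (G : GateSet) : Prop :=
  ∃ N₀ : ℕ, ∀ N ≥ N₀, ∀ U ∈ Matrix.unitaryGroup (Fin N → Fin 2) ℂ, ∀ δ > (0 : ℝ),
    ∃ (C : Circuit G (Fin N)) (c : ℂ), ‖c‖ = 1 ∧
      ∀ x y, ‖Circuit.toMat C x y - c * U x y‖ < δ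

/-! ### Efficient effect operators -/

/-- The effect operator `E` is implemented with at most `k` gates: append `a` ancillas in the state
`|0⟩`, run a circuit, measure one qubit `j`; the effect `E` corresponds to the outcome `b`. -/
def ImplementableWith (G : GateSet) {n : ℕ} (E : QMat (Fin n)) (k : ℕ) : Prop :=
  ∃ (a : ℕ) (C : Circuit G (Fin n ⊕ Fin a)) (j : Fin n ⊕ Fin a) (b : Fin 2),
    C.length ≤ k ∧
    E = ((Circuit.toMat C).conjTranspose *
          Matrix.diagonal (fun x : (Fin n ⊕ Fin a) → Fin 2 => if x j = b then (1 : ℂ) else 0) *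
          Circuit.toMat C).submatrix
        (fun x => Sum.elim x (fun _ => 0)) (fun x => Sum.elim x (fun _ => 0))

/-- An informationally complete polynomially generated set of effect operators over the gate set
`G`: a family of sets `eff n` of effect operators on `n` qubits. -/
structure EffectFamily (G : GateSet) where
  eff : ∀ n : ℕ, Set (QMat (Fin n))
  poly : Polynomial ℕ
  isEffect : ∀ n, ∀ E ∈ eff n, E.PosSemidef ∧ (1 - E).PosSemidef
  efficient : ∀ n, ∀ E ∈ eff n, ImplementableWith G E (poly.eval n)
  compl_mem : ∀ n, ∀ E ∈ eff n, 1 - E ∈ eff n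
  tensor_mem : ∀ n₁ n₂, ∀ E₁ ∈ eff n₁, ∀ E₂ ∈ eff n₂, ∀ c₁ c₂ : ℕ,
    ImplementableWith G E₁ c₁ → ImplementableWith G E₂ c₂ → c₁ + c₂ < poly.eval (n₁ + n₂) →
    relabel finSumFinEquiv (tensor E₁ E₂) ∈ eff (n₁ + n₂)
  span_eq_top : ∀ n, Submodule.span ℂ (eff n) = ⊤

/-- The efficient effect operators on `a + b` qubits, the first `a` of which belong to `A` and the
last `b` to `B`. -/
def EffectFamily.bipartite {G : GateSet} (𝓔 : EffectFamily G) (a b : ℕ) :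
    Set (QMat (Fin a ⊕ Fin b)) :=
  {E | relabel finSumFinEquiv E ∈ 𝓔.eff (a + b)}

/-! ### Computational measured relative entropy of entanglement -/

/-- The relative entropy (in bits) of two probability vectors, `+∞` unless `p ≪ q`. -/
def relEntropy {k : ℕ} (p q : Fin k → ℝ) : EReal :=
  open Classical in
  if ∀ i, q i = 0 → p i = 0 then ((∑ i, p i * Real.logb 2 (p i / q i) : ℝ) : EReal) else ⊤

/-- The outcome distribution of the binary measurement `(E, 1 - E)` in the state `ρ`. -/
def outcome {V : Type} [Fintype V] [DecidableEq V] (E ρ : QMat V) : Fin 2 → ℝ :=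
  ![(E * ρ).trace.re, ((1 - E) * ρ).trace.re]

/-- The measured relative entropy for the binary measurements `(E, 1 - E)`, `E ∈ 𝓜`. -/
def measuredRelEntropy {V : Type} [Fintype V] [DecidableEq V] (𝓜 : Set (QMat V))
    (ρ σ : QMat V) : EReal :=
  ⨆ E ∈ 𝓜, relEntropy (outcome E ρ) (outcome E σ)

/-- The separable states. -/
def SEP (V W : Type) [Fintype V] [DecidableEq V] [Fintype W] [DecidableEq W] : Set (QMat (V ⊕ W)) :=
  convexHull ℝ {σ | ∃ (σA : QMat V) (σB : QMat W), IsState σA ∧ IsState σB ∧ σ = tensor σA σB}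

/-- The computational measured relative entropy of entanglement of a state on `n + n` qubits. -/
def compER {G : GateSet} (𝓔 : EffectFamily G) {n : ℕ} (ρ : QMat (Fin n ⊕ Fin n)) : EReal :=
  ⨅ σ ∈ SEP (Fin n) (Fin n), measuredRelEntropy (𝓔.bipartite n n) ρ σ

/-! ### LOCC maps -/

/-- The circuit description of an LOCC map from `nA + nB` to `mA + mB` qubits: ancilla registers
`A'`, `B'` of `tA`, `tB` qubits, a communication register `C` of `c` qubits, in each round a circuit
of Alice on `A A' C` and one of Bob on `B B' C`. The output registers consist of qubits of `A A'`
and of `B B'`. -/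
structure LOCC (G : GateSet) (nA nB mA mB : ℕ) where
  tA : ℕ
  tB : ℕ
  c : ℕ
  rounds : List (Circuit G ((Fin nA ⊕ Fin tA) ⊕ Fin c) × Circuit G ((Fin nB ⊕ Fin tB) ⊕ Fin c))
  outA : Fin mA ↪ Fin nA ⊕ Fin tA
  outB : Fin mB ↪ Fin nB ⊕ Fin tB

namespace LOCC

variable {G : GateSet} {nA nB mA mB : ℕ} (Γ : LOCC G nA nB mA mB)

/-- The labels of all the qubits: `A A'`, `B B'` and `C`. -/
abbrev Reg : Type := ((Fin nA ⊕ Fin Γ.tA) ⊕ (Fin nB ⊕ Fin Γ.tB)) ⊕ Fin Γ.c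

/-- The registers `A A' C`. -/
def regA : (Fin nA ⊕ Fin Γ.tA) ⊕ Fin Γ.c ↪ Γ.Reg :=
  Function.Embedding.inl.sumMap (Function.Embedding.refl _)

/-- The registers `B B' C`. -/
def regB : (Fin nB ⊕ Fin Γ.tB) ⊕ Fin Γ.c ↪ Γ.Reg :=
  Function.Embedding.inr.sumMap (Function.Embedding.refl _)

/-- The register `C`. -/
def regC : Fin Γ.c ↪ Γ.Reg := Function.Embedding.inr

/-- The input registers `A B`. -/
def regIn : Fin nA ⊕ Fin nB ↪ Γ.Reg :=
  (Function.Embedding.inl.sumMap Function.Embedding.inl).trans Function.Embedding.inl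

/-- The output registers. -/
def regOut : Fin mA ⊕ Fin mB ↪ Γ.Reg :=
  (Γ.outA.sumMap Γ.outB).trans Function.Embedding.inl

/-- Running a circuit, then measuring `C`. -/
def halfRound (C : Circuit G Γ.Reg) (ρ : QMat Γ.Reg) : QMat Γ.Reg :=
  measureReg Γ.regC (Circuit.toMat C * ρ * (Circuit.toMat C).conjTranspose)

/-- One round: Alice's circuit, measurement of `C`, Bob's circuit, measurement of `C`. -/
def round (ρ : QMat Γ.Reg)
    (R : Circuit G ((Fin nA ⊕ Fin Γ.tA) ⊕ Fin Γ.c) × Circuit G ((Fin nB ⊕ Fin Γ.tB) ⊕ Fin Γ.c)) :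
    QMat Γ.Reg :=
  Γ.halfRound (Circuit.embed Γ.regB R.2) (Γ.halfRound (Circuit.embed Γ.regA R.1) ρ)

/-- The map implemented by the circuit description. -/
def map (ρ : QMat (Fin nA ⊕ Fin nB)) : QMat (Fin mA ⊕ Fin mB) :=
  reduceTo Γ.regOut (Γ.rounds.foldl Γ.round (addAncillas Γ.regIn ρ))

/-- The total number of gates, with the creation of the ancillas and the measurements of the
qubits of `C` (twice in each round). -/
def cost : ℕ :=
  Γ.tA + Γ.tB + Γ.c + (Γ.rounds.map fun R => R.1.length + R.2.length + 2 * Γ.c).sum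

end LOCC

/-- A family of LOCC maps is efficient if its circuit descriptions have polynomial size. -/
def EfficientLOCC {G : GateSet} {nA nB mA mB : ℕ → ℕ}
    (Γ : ∀ n, LOCC G (nA n) (nB n) (mA n) (mB n)) : Prop :=
  ∃ c : Polynomial ℕ, ∀ n, 1 ≤ n → (Γ n).cost ≤ c.eval n

/-- Test stability `Γ^*(𝓜out) ⊆ conv 𝓜in`, where `F = Γ^*(E)` is characterized by
`Tr[F X] = Tr[E Γ(X)]` for all `X`. -/
def TestStable {V W : Type} [Fintype V] [DecidableEq V] [Fintype W] [DecidableEq W]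
    (𝓜in : Set (QMat V)) (𝓜out : Set (QMat W)) (Γ : QMat V → QMat W) : Prop :=
  ∀ E ∈ 𝓜out, ∃ F ∈ convexHull ℝ 𝓜in, ∀ X : QMat V, (F * X).trace = (E * Γ X).trace

/-! ### Entanglement cost and distillable entanglement -/

/-- The trace norm `‖X‖₁ = Tr √(X^* X)`. -/
def traceNorm {V : Type} [Fintype V] [DecidableEq V] (X : QMat V) : ℝ :=
  (CFC.sqrt (X.conjTranspose * X)).trace.re

/-- The fidelity `F(ρ, σ) = ‖√ρ √σ‖₁²`. -/
def fidelity {V : Type} [Fintype V] [DecidableEq V] (ρ σ : QMat V) : ℝ :=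
  traceNorm (CFC.sqrt ρ * CFC.sqrt σ) ^ 2

/-- The vector `|Φ_n⟩ = 2^{-n/2} ∑_i |i⟩|i⟩`. -/
def bellVec (n : ℕ) : (Fin n ⊕ Fin n → Fin 2) → ℂ :=
  fun x => if ∀ i, x (Sum.inl i) = x (Sum.inr i) then ((1 / Real.sqrt (2 ^ n) : ℝ) : ℂ) else 0

/-- The projector `Φ^{⊗ n} = |Φ_n⟩⟨Φ_n|` onto `n` Bell pairs. -/
def bell (n : ℕ) : QMat (Fin n ⊕ Fin n) :=
  Matrix.vecMulVec (bellVec n) (star (bellVec n))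

/-- `m` is a lower bound on the one-shot computational distillable entanglement of `ρ` with
error `ε`: there is an efficient family of free LOCC maps distilling `m n` Bell pairs from `ρ n`.
Free means test stable: efficient effects on the output (`𝓔out`) are pulled back to convex
combinations of efficient effects on the input (`𝓔in`). -/
def IsDistillable {G : GateSet} (𝓔in 𝓔out : EffectFamily G) (ε : ℕ → ℝ)
    (ρ : ∀ n, QMat (Fin n ⊕ Fin n)) (m : ℕ → ℕ) : Prop :=
  ∃ Γ : ∀ n, LOCC G n n (m n) (m n), EfficientLOCC Γ ∧
    ∀ n, 1 ≤ n →
      TestStable (𝓔in.bipartite n n) (𝓔out.bipartite (m n) (m n)) (Γ n).map ∧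
      1 - fidelity ((Γ n).map (ρ n)) (bell (m n)) ≤ ε n

/-- `k` is an upper bound on the one-shot computational entanglement cost of `ρ` with error `ε`:
there is an efficient family of LOCC maps producing `ρ n` from `k n` Bell pairs. -/
def IsCost (G : GateSet) (ε : ℕ → ℝ) (ρ : ∀ n, QMat (Fin n ⊕ Fin n)) (k : ℕ → ℕ) : Prop :=
  ∃ Γ : ∀ n, LOCC G (k n) (k n) n n, EfficientLOCC Γ ∧
    ∀ n, 1 ≤ n → 1 - fidelity (ρ n) ((Γ n).map (bell (k n))) ≤ ε n

/-- The computational distillable entanglement at `n`. -/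
def distillableEntanglement {G : GateSet} (𝓔in 𝓔out : EffectFamily G) (ε : ℕ → ℝ)
    (ρ : ∀ n, QMat (Fin n ⊕ Fin n)) (n : ℕ) : EReal :=
  ⨆ (m : ℕ → ℕ) (_ : IsDistillable 𝓔in 𝓔out ε ρ m), (m n : EReal)

/-- The computational entanglement cost at `n`. -/
def entanglementCost (G : GateSet) (ε : ℕ → ℝ)
    (ρ : ∀ n, QMat (Fin n ⊕ Fin n)) (n : ℕ) : EReal :=
  ⨅ (k : ℕ → ℕ) (_ : IsCost G ε ρ k), (k n : EReal)

/-- `(1 + s) h(s / (1 + s)) + s (κ + log (2 / s))`, with logarithms to base 2 and `h` the binary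
entropy in bits (the value at `s = 0` is `0`). -/
def contTerm (s κ : ℝ) : ℝ :=
  (1 + s) * (Real.binEntropy (s / (1 + s)) / Real.log 2) + s * (κ + Real.logb 2 (2 / s))

end

end CompEnt

namespace CompEnt

open scoped MatrixOrder ComplexOrder

noncomputable section

/-! ### Relative entropy of probability vectors -/

/-! LOCC circuits preserve separability: on a product vector with the communication register in a
basis state, a local circuit followed by the measurement of that register gives a mixture of vectors
of the same kind (`LOCC.isFreeMap_map`). Two facts about separable operators complete the picture. A
separable state overlaps `Φ^{⊗m}` by at most `2^{-m}` (`re_trace_bell_mul_le`). Every `X ≥ 0` on `n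
+ n` qubits satisfies `X ≤ 2^n X'`, where `X'`, the dephasing of `X` on Alice's side, is separable
up to normalization (`posSemidef_smul_measureReg_sub`, `isFreeMap_pinching`).

Distillation: pulling `Φ^{⊗m}` back through `Γ` gives a test `F` in the convex hull of the efficient
effects, with `p = Tr Fρ ≥ 1 - ε` and `Tr Fσ ≤ 2^{-m}` for every separable `σ`. The variational
lower bound on the relative entropy is affine in the test, so it passes from the effects to `F` and
gives `E_R ≥ p m - h(p)` (`mul_sub_binEntropy_le`). It remains to see that `(1 - p) m + h(p) ≤ g`.
This is elementary for `m ≤ κ`. For `ε ≤ 1/2` the pinching inequality forces `m ≤ n + 1`, and the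
surplus `ε` fits into the slack of `g`.

Cost: put `s = √ε`. The Fuchs–van de Graaf inequality gives `ρ ≤ Γ(Φ^{⊗k}) + N` with `Tr N = s`.
Dephasing the Bell pairs before `Γ`, and dephasing `N`, produces separable `σ'` and `M` with
`Γ(Φ^{⊗k}) ≤ 2^k σ'` and `N ≤ 2^n M`. The separable state `(σ' + M)/(1 + s)` is the candidate in
`E_R`. For each test these dominations reduce the claim to an estimate for probability vectors
(`relEntropy_le_of_le_add`), with value at most `k + g(s, n)`. -/

lemma mul_log_add_le_mul_log_div {p q x : ℝ} (hp : 0 ≤ p) (hq : 0 ≤ q) (hpq : q = 0 → p = 0)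
    (hx : 0 ≤ x) (hpx : x = 0 → p = 0) :
    p * Real.log x + p - q * x ≤ p * Real.log (p / q) := by
  rcases hp.eq_or_lt with rfl | hp
  · simpa using mul_nonneg hq hx
  have hq' : 0 < q := hq.lt_of_ne fun h => hp.ne' (hpq h.symm)
  have hx' : 0 < x := hx.lt_of_ne fun h => hp.ne' (hpx h.symm)
  -- The tangent bound `log z ≤ z - 1` at `z = q x / p`.
  have h := Real.log_le_sub_one_of_pos (show 0 < q * x / p by positivity)
  rw [Real.log_div (by positivity) hp.ne', Real.log_mul hq'.ne' hx'.ne'] at h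
  rw [Real.log_div hp.ne' hq'.ne']
  have h2 := mul_le_mul_of_nonneg_left h hp.le
  have h3 : p * (q * x / p - 1) = q * x - p := by field_simp
  linarith

lemma mul_log_div_le_mul_log {p q K : ℝ} (hp : 0 ≤ p) (hq : 0 ≤ q)
    (h : p ≤ K * q) : p * Real.log (p / q) ≤ p * Real.log K := by
  rcases hp.eq_or_lt with rfl | hp
  · simp
  have hq' : 0 < q := by
    by_contra hn
    have : q = 0 := le_antisymm (not_lt.1 hn) hq
    subst this
    linarith
  gcongr
  rwa [div_le_iff₀ hq']

/-- Write `W = p' + d`, `Q = q' + e` and `r = W - p`. Then `p log(W/Q) = W log(W/Q) - r log(W/Q)`.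
The first term is controlled by the log-sum inequality, and `r log(W/Q) ≥ r log(r/Q) ≥ r log y + r -
Q y`. The free parameter `y` is chosen only after summation, the same for all components. -/
lemma mul_log_div_le_of_le_add {p q p' q' d e s K L y : ℝ} (hp : 0 ≤ p) (hp' : 0 ≤ p')
    (hq' : 0 ≤ q') (hd : 0 ≤ d) (he : 0 ≤ e) (hs : 0 ≤ s)
    (hq : (1 + s) * q = q' + e) (hle : p ≤ p' + d) (hpK : p' ≤ K * q') (hdL : d ≤ L * e)
    (hy : 0 ≤ y) (hya : y = 0 → p = p' + d) :
    p * Real.log (p / q) ≤ p * Real.log (1 + s) + p' * Real.log K + d * Real.log L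
      - ((p' + d - p) * Real.log y + (p' + d - p) - (1 + s) * q * y) := by
  have hs1 : 0 < 1 + s := by linarith
  have hQ0 : q' + e = 0 → p' = 0 ∧ d = 0 := by
    intro h
    have h1 : q' = 0 := by linarith
    have h2 : e = 0 := by linarith
    subst h1 h2
    constructor <;> linarith
  have hq0' : q' = 0 → p' = 0 := by
    rintro rfl
    linarith
  have he0' : e = 0 → d = 0 := by
    rintro rfl
    linarith
  -- Log-sum inequality: both summands use the tangent bound at the common point `W/Q`, where the
  -- linear terms cancel.
  have hlogsum : (p' + d) * Real.log ((p' + d) / (q' + e)) ≤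
      p' * Real.log K + d * Real.log L := by
    have hx : 0 ≤ (p' + d) / (q' + e) := by positivity
    have hx0 : (p' + d) / (q' + e) = 0 → p' = 0 ∧ d = 0 := by
      intro h
      rcases div_eq_zero_iff.1 h with h | h
      · constructor <;> linarith
      · exact hQ0 h
    have h1 := mul_log_add_le_mul_log_div hp' hq' hq0' hx fun h => (hx0 h).1
    have h2 := mul_log_add_le_mul_log_div hd he he0' hx fun h => (hx0 h).2
    have h3 := mul_log_div_le_mul_log hp' hq' hpK
    have h4 := mul_log_div_le_mul_log hd he hdL
    have h5 : (q' + e) * ((p' + d) / (q' + e)) = p' + d := by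
      by_cases h : q' + e = 0
      · obtain ⟨h6, h7⟩ := hQ0 h
        simp [h6, h7]
      · field_simp
    nlinarith
  have hrest := mul_log_add_le_mul_log_div (p := p' + d - p) (q := q' + e) (x := y) (by linarith)
    (by linarith) (fun h => by obtain ⟨h6, h7⟩ := hQ0 h; linarith) hy
    (fun h => by have := hya h; linarith)
  have hmono : (p' + d - p) * Real.log ((p' + d - p) / (q' + e)) ≤
      (p' + d - p) * Real.log ((p' + d) / (q' + e)) := by
    rcases (sub_nonneg.2 hle).eq_or_lt with h | h
    · simp [← h]
    have : 0 < q' + e := by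
      refine lt_of_le_of_ne (by linarith) fun h0 => ?_
      obtain ⟨h6, h7⟩ := hQ0 h0.symm
      linarith
    gcongr
    linarith
  have hpart : p * Real.log (p / q) ≤
      p * Real.log (1 + s) + p * Real.log ((p' + d) / (q' + e)) := by
    rcases hp.eq_or_lt with rfl | hp
    · simp
    have hQ : 0 < q' + e := by
      refine lt_of_le_of_ne (by linarith) fun h0 => ?_
      obtain ⟨h6, h7⟩ := hQ0 h0.symm
      linarith
    have hq0 : 0 < q := by
      by_contra h
      nlinarith
    have hW : 0 < p' + d := by linarith
    rw [← mul_add, ← Real.log_mul hs1.ne' (by positivity), ← hq]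
    gcongr
    rw [mul_div_assoc', mul_div_mul_left _ _ hs1.ne']
    gcongr
  rw [hq]
  have : (p' + d - p) * Real.log ((p' + d) / (q' + e)) + p * Real.log ((p' + d) / (q' + e)) =
    (p' + d) * Real.log ((p' + d) / (q' + e)) := by ring
  linarith

/-- One half of the variational formula for the relative entropy. For fixed `x` the left-hand side
is affine in `(p, q)`, hence in the effect that produces them; this is what later allows convex
combinations of effects. -/
lemma sum_le_of_relEntropy_le {k : ℕ} {p q x : Fin k → ℝ} {r : ℝ} (hp : ∀ i, 0 ≤ p i)
    (hq : ∀ i, 0 ≤ q i) (hx : ∀ i, 0 < x i) (h : relEntropy p q ≤ (r : EReal)) :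
    ∑ i, (p i * Real.log (x i) + p i - q i * x i) ≤ r * Real.log 2 := by
  unfold relEntropy at h
  split_ifs at h with h0
  · rw [EReal.coe_le_coe_iff] at h
    have hl : 0 < Real.log 2 := Real.log_pos one_lt_two
    calc _ ≤ ∑ i, p i * Real.log (p i / q i) := Finset.sum_le_sum fun i _ =>
          mul_log_add_le_mul_log_div (hp i) (hq i) (h0 i) (hx i).le fun h => absurd h (hx i).ne'
      _ = (∑ i, p i * Real.logb 2 (p i / q i)) * Real.log 2 := by
          rw [Finset.sum_mul]
          refine Finset.sum_congr rfl fun i _ => ?_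
          rw [Real.logb]
          field_simp
      _ ≤ r * Real.log 2 := by gcongr
  · exact absurd h (by simp)

/-- The componentwise estimate is summed with `y = s / (1 + s)`: the excesses `p' + d - p` add up to
`s` and the `(1 + s) q` to `1 + s`, so the linear remainder vanishes. -/
lemma relEntropy_le_of_le_add {k : ℕ} {p q p' q' d e : Fin k → ℝ} {s K L : ℝ}
    (hp : ∀ i, 0 ≤ p i) (hp' : ∀ i, 0 ≤ p' i) (hq' : ∀ i, 0 ≤ q' i) (hd : ∀ i, 0 ≤ d i)
    (he : ∀ i, 0 ≤ e i) (hs : 0 ≤ s)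
    (hq : ∀ i, (1 + s) * q i = q' i + e i) (hle : ∀ i, p i ≤ p' i + d i)
    (hpK : ∀ i, p' i ≤ K * q' i) (hdL : ∀ i, d i ≤ L * e i) (sp : ∑ i, p i = 1)
    (sp' : ∑ i, p' i = 1) (sq' : ∑ i, q' i = 1) (sd : ∑ i, d i = s) (se : ∑ i, e i = s) :
    relEntropy p q ≤ (((Real.log (1 + s) + Real.log K + s * Real.log L
      - s * Real.log (s / (1 + s))) / Real.log 2 : ℝ) : EReal) := by
  have hs1 : 0 < 1 + s := by linarith
  have hq0 : ∀ i, q i = 0 → p i = 0 := by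
    intro i h
    have h1 := hq i
    rw [h] at h1
    have h2 : q' i = 0 := by linarith [hq' i, he i]
    have h3 : e i = 0 := by linarith [hq' i, he i]
    have h4 := hpK i
    have h5 := hdL i
    rw [h2] at h4
    rw [h3] at h5
    linarith [hp i, hle i]
  rw [relEntropy, if_pos hq0, EReal.coe_le_coe_iff, le_div_iff₀ (Real.log_pos one_lt_two),
    Finset.sum_mul]
  have key : ∀ i, p i * Real.logb 2 (p i / q i) * Real.log 2 ≤
      p i * Real.log (1 + s) + p' i * Real.log K + d i * Real.log L
      - ((p' i + d i - p i) * Real.log (s / (1 + s)) + (p' i + d i - p i)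
        - (1 + s) * q i * (s / (1 + s))) := by
    intro i
    refine le_of_eq_of_le ?_ (mul_log_div_le_of_le_add (hp i) (hp' i) (hq' i) (hd i) (he i) hs
      (hq i) (hle i) (hpK i) (hdL i) (y := s / (1 + s)) (by positivity) fun hy => ?_)
    · rw [Real.logb]
      field_simp
    -- Here `y = 0` means `s = 0`; the excesses are then nonnegative with sum zero, so each one
    -- vanishes.
    · have hs0 : s = 0 := by
        rcases div_eq_zero_iff.1 hy with h | h <;> linarith
      have h0 : ∑ j, (p' j + d j - p j) = 0 := by
        rw [Finset.sum_sub_distrib, Finset.sum_add_distrib, sp, sp', sd, hs0]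
        ring
      have := (Finset.sum_eq_zero_iff_of_nonneg fun j _ => sub_nonneg.2 (hle j)).1 h0 i
        (Finset.mem_univ i)
      linarith
  refine (Finset.sum_le_sum fun i _ => key i).trans (le_of_eq ?_)
  have sq : ∑ i, q i = 1 := by
    have : (1 + s) * ∑ i, q i = 1 + s := by
      rw [Finset.mul_sum, Finset.sum_congr rfl fun i _ => hq i, Finset.sum_add_distrib, sq', se]
    exact mul_left_cancel₀ hs1.ne' (by linarith)
  simp only [Finset.sum_sub_distrib, Finset.sum_add_distrib, ← Finset.sum_mul, ← Finset.mul_sum,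
    sp, sp', sd, sq]
  field_simp
  ring

/-! ### The continuity term -/

lemma contTerm_mul_log_two {s : ℝ} (hs : 0 ≤ s) (κ : ℝ) :
    contTerm s κ * Real.log 2 = (1 + s) * Real.log (1 + s) - s * Real.log s
      + s * (κ * Real.log 2 + Real.log 2 - Real.log s) := by
  have hl : Real.log 2 ≠ 0 := (Real.log_pos one_lt_two).ne'
  have hs1 : 1 + s ≠ 0 := by linarith
  rcases hs.eq_or_lt with rfl | hs
  · simp [contTerm]
  have h1 : 1 - s / (1 + s) = 1 / (1 + s) := by field_simp; ring
  rw [contTerm, Real.binEntropy, h1, Real.logb, inv_div, one_div, inv_inv,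
    Real.log_div hs1 hs.ne', Real.log_div two_ne_zero hs.ne']
  field_simp
  ring

lemma contTerm_nonneg {s κ : ℝ} (hs : 0 ≤ s) (hs1 : s ≤ 1) (hκ : 0 ≤ κ) : 0 ≤ contTerm s κ := by
  have hl : 0 < Real.log 2 := Real.log_pos one_lt_two
  refine nonneg_of_mul_nonneg_left (b := Real.log 2) ?_ hl
  rw [contTerm_mul_log_two hs]
  have h1 : 0 ≤ Real.log (1 + s) := Real.log_nonneg (by linarith)
  have h2 : Real.log s ≤ 0 := Real.log_nonpos hs hs1
  have h3 := mul_nonneg hs (neg_nonneg.2 h2)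
  have h4 := mul_nonneg hs (mul_nonneg hκ hl.le)
  nlinarith

/-- The two sides differ by `s log (2 / s)`, which is nonnegative for `s ≤ 1`. -/
lemma entropy_bound_le_contTerm {s : ℝ} (hs : 0 ≤ s) (hs1 : s ≤ 1) (k : ℝ) (κ : ℝ) :
    (Real.log (1 + s) + k * Real.log 2 + s * (κ * Real.log 2)
      - s * Real.log (s / (1 + s))) / Real.log 2 ≤ k + contTerm s κ := by
  have hl : 0 < Real.log 2 := Real.log_pos one_lt_two
  rw [div_le_iff₀ hl, add_mul, contTerm_mul_log_two hs]
  rcases hs.eq_or_lt with rfl | hs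
  · simp
  rw [Real.log_div hs.ne' (by linarith)]
  have h2 : Real.log s ≤ 0 := Real.log_nonpos hs.le hs1
  nlinarith

lemma le_one_add_mul_log {s : ℝ} (hs : 0 ≤ s) : s ≤ (1 + s) * Real.log (1 + s) := by
  have h := Real.one_sub_inv_le_log_of_pos (show 0 < 1 + s by linarith)
  have h2 := mul_le_mul_of_nonneg_left h (show 0 ≤ 1 + s by linarith)
  have h3 : (1 + s) * (1 - (1 + s)⁻¹) = s := by
    have : 1 + s ≠ 0 := by linarith
    field_simp
    ring
  linarith

/-- Up to `1/2` the binary entropy increases, so `t` may be replaced by `s²`, and `h(s²) ≤ -2 s² log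
s + s²` in nats. The three terms `s²`, `-2 s² log s` and `s² log 2` are dominated by `(1 + s) log (1
+ s)`, `-2 s log s` and `s log 2`, which make up `contTerm s 0`. -/
lemma binEntropy_add_sq_le {s t : ℝ} (hs : 0 ≤ s) (ht0 : 0 ≤ t) (hts : t ≤ s ^ 2)
    (hs2 : s ^ 2 ≤ 1 / 2) :
    Real.binEntropy t + s ^ 2 * Real.log 2 ≤ contTerm s 0 * Real.log 2 := by
  have hl : 0 < Real.log 2 := Real.log_pos one_lt_two
  have hs1 : s ≤ 1 := by nlinarith
  have hmono : Real.binEntropy t ≤ Real.binEntropy (s ^ 2) :=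
    Real.binEntropy_strictMonoOn.monotoneOn ⟨ht0, by norm_num; linarith⟩
      ⟨by positivity, by norm_num; linarith⟩ hts
  rw [contTerm_mul_log_two hs]
  have h1 : Real.binEntropy (s ^ 2) ≤ -(2 * s ^ 2 * Real.log s) + s ^ 2 := by
    rw [Real.binEntropy, Real.log_inv, Real.log_inv, Real.log_pow]
    have h := Real.one_sub_inv_le_log_of_pos (show 0 < 1 - s ^ 2 by linarith)
    have h2 := mul_le_mul_of_nonneg_left h (show 0 ≤ 1 - s ^ 2 by linarith)
    have h3 : (1 - s ^ 2) * (1 - (1 - s ^ 2)⁻¹) = - s ^ 2 := by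
      have : 1 - s ^ 2 ≠ 0 := by linarith
      field_simp
      ring
    push_cast
    linarith
  have h2 : Real.log s ≤ 0 := Real.log_nonpos hs hs1
  have h3 := le_one_add_mul_log hs
  have h4 : s ^ 2 ≤ s := by nlinarith
  nlinarith [mul_nonneg (sub_nonneg.2 h4) (neg_nonneg.2 h2), mul_nonneg (sub_nonneg.2 h4) hl.le]

lemma binEntropy_le_contTerm {s t : ℝ} (hs : 0 ≤ s) (hs1 : s ≤ 1) (ht0 : 0 ≤ t)
    (hts : t ≤ s ^ 2) : Real.binEntropy t ≤ contTerm s 0 * Real.log 2 := by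
  have hl : 0 < Real.log 2 := Real.log_pos one_lt_two
  rcases le_total (s ^ 2) (1 / 2) with h | h
  · nlinarith [binEntropy_add_sq_le hs ht0 hts h, mul_nonneg (sq_nonneg s) hl.le]
  · rw [contTerm_mul_log_two hs]
    -- Since `0.7 > log 2`, the bound `(1 + s) log (1 + s) ≥ s` alone exceeds the maximum of the
    -- binary entropy.
    have h1 : (0.7 : ℝ) ≤ s := by nlinarith
    have h2 : Real.log s ≤ 0 := Real.log_nonpos hs hs1
    have h3 := le_one_add_mul_log hs
    have h4 := Real.log_two_lt_d9
    have h5 : Real.binEntropy t ≤ Real.log 2 := Real.binEntropy_le_log_two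
    nlinarith [mul_nonneg hs (neg_nonneg.2 h2), mul_nonneg hs hl.le]

lemma contTerm_eq_add (s κ : ℝ) : contTerm s κ = contTerm s 0 + s * κ := by
  simp only [contTerm]
  ring

/-- The loss `t m` is at most `s² m`, and `s² κ ≤ s κ`. If `m` exceeds `κ` by up to one, the
additional `s²` is absorbed by `binEntropy_add_sq_le`. -/
lemma le_sub_binEntropy_add_contTerm {s t κ m : ℝ} (hs : 0 ≤ s) (hs1 : s ≤ 1) (ht0 : 0 ≤ t)
    (hts : t ≤ s ^ 2) (hm : 0 ≤ m) (hκ : 0 ≤ κ)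
    (hmκ : m ≤ κ ∨ s ^ 2 ≤ 1 / 2 ∧ m ≤ κ + 1) :
    m ≤ (1 - t) * m - Real.binEntropy t / Real.log 2 + contTerm s κ := by
  have hl : 0 < Real.log 2 := Real.log_pos one_lt_two
  have h4 : s ^ 2 ≤ s := by nlinarith
  have htm : t * m ≤ s ^ 2 * m := by gcongr
  rw [contTerm_eq_add]
  suffices Real.binEntropy t / Real.log 2 ≤ contTerm s 0 + s * κ - s ^ 2 * m by linarith
  rcases hmκ with h | ⟨h, h'⟩
  · have h5 : Real.binEntropy t / Real.log 2 ≤ contTerm s 0 := by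
      rw [div_le_iff₀ hl]
      exact binEntropy_le_contTerm hs hs1 ht0 hts
    nlinarith [mul_nonneg (sub_nonneg.2 h4) hm]
  · have h5 : Real.binEntropy t / Real.log 2 ≤ contTerm s 0 - s ^ 2 := by
      rw [div_le_iff₀ hl]
      linarith [binEntropy_add_sq_le hs ht0 hts h]
    nlinarith [mul_nonneg (sub_nonneg.2 h4) hκ, mul_nonneg (sq_nonneg s) (sub_nonneg.2 h')]


/-! ### Trace inequalities -/

section Matrices

open Matrix

variable {n : Type*} [Fintype n]

lemma posSemidef_of_idempotent {Q : Matrix n n ℂ} (h : Qᴴ = Q) (h2 : Q * Q = Q) :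
    Q.PosSemidef := by
  have := posSemidef_conjTranspose_mul_self Q
  rwa [h, h2] at this

lemma re_trace_conjTranspose_mul_self (A : Matrix n n ℂ) :
    (Aᴴ * A).trace.re = ∑ p : n × n, ‖A p.1 p.2‖ ^ 2 := by
  rw [Fintype.sum_prod_type, Finset.sum_comm]
  simp only [trace, diag, mul_apply, conjTranspose_apply, Complex.re_sum]
  refine Finset.sum_congr rfl fun i _ => Finset.sum_congr rfl fun j _ => ?_
  rw [Complex.star_def, Complex.conj_mul', ← Complex.ofReal_pow, Complex.ofReal_re]

lemma norm_trace_conjTranspose_mul_le (A B : Matrix n n ℂ) :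
    ‖(Aᴴ * B).trace‖ ≤ √(Aᴴ * A).trace.re * √(Bᴴ * B).trace.re := by
  rw [re_trace_conjTranspose_mul_self, re_trace_conjTranspose_mul_self]
  refine le_trans ?_ (Real.sum_mul_le_sqrt_mul_sqrt _ _ _)
  rw [Fintype.sum_prod_type, Finset.sum_comm]
  simp only [trace, diag, mul_apply, conjTranspose_apply]
  refine (norm_sum_le _ _).trans (Finset.sum_le_sum fun i _ => ?_)
  refine (norm_sum_le _ _).trans (Finset.sum_le_sum fun j _ => ?_)
  simp

variable [DecidableEq n]

lemma exists_unitary_diagonal {A : Matrix n n ℂ} (hA : A.IsHermitian) :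
    ∃ (V : Matrix n n ℂ) (l : n → ℝ), Vᴴ * V = 1 ∧ V * Vᴴ = 1 ∧
      A = V * diagonal (fun i => (l i : ℂ)) * Vᴴ := by
  refine ⟨hA.eigenvectorUnitary, hA.eigenvalues, ?_, ?_, ?_⟩
  · exact Unitary.coe_star_mul_self hA.eigenvectorUnitary
  · exact Unitary.coe_mul_star_self hA.eigenvectorUnitary
  · conv_lhs => rw [hA.spectral_theorem]
    rfl

lemma conj_diagonal_mul {V : Matrix n n ℂ} (h : Vᴴ * V = 1) (a b : n → ℂ) :
    V * diagonal a * Vᴴ * (V * diagonal b * Vᴴ) = V * diagonal (fun i => a i * b i) * Vᴴ := by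
  calc _ = V * diagonal a * (Vᴴ * V) * diagonal b * Vᴴ := by simp only [Matrix.mul_assoc]
    _ = _ := by rw [h, Matrix.mul_one, Matrix.mul_assoc V, diagonal_mul_diagonal]

lemma conjTranspose_conj_diagonal (V : Matrix n n ℂ) (a : n → ℝ) :
    (V * diagonal (fun i => (a i : ℂ)) * Vᴴ)ᴴ = V * diagonal (fun i => (a i : ℂ)) * Vᴴ := by
  simp only [conjTranspose_mul, conjTranspose_conjTranspose, diagonal_conjTranspose,
    Matrix.mul_assoc]
  congr 3
  ext i
  simp

lemma posSemidef_conj_diagonal (V : Matrix n n ℂ) {a : n → ℝ} (ha : ∀ i, 0 ≤ a i) :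
    (V * diagonal (fun i => (a i : ℂ)) * Vᴴ).PosSemidef :=
  (PosSemidef.diagonal fun i => by simpa using ha i).mul_mul_conjTranspose_same V

/-- The positive part of a Hermitian matrix and its support projection. -/
lemma exists_posPart {A : Matrix n n ℂ} (hA : A.IsHermitian) :
    ∃ N P : Matrix n n ℂ, N.PosSemidef ∧ (N - A).PosSemidef ∧ Pᴴ = P ∧ P * P = P ∧ P * A = N := by
  obtain ⟨V, l, h1, -, rfl⟩ := exists_unitary_diagonal hA
  refine ⟨V * diagonal (fun i => ((max (l i) 0 : ℝ) : ℂ)) * Vᴴ,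
    V * diagonal (fun i => ((if 0 < l i then 1 else 0 : ℝ) : ℂ)) * Vᴴ,
    posSemidef_conj_diagonal V fun i => le_max_right _ _, ?_, conjTranspose_conj_diagonal _ _, ?_,
    ?_⟩
  · rw [← Matrix.sub_mul, ← Matrix.mul_sub, diagonal_sub]
    have := posSemidef_conj_diagonal V (a := fun i => max (l i) 0 - l i)
      fun i => sub_nonneg.2 (le_max_left _ _)
    simpa only [Complex.ofReal_sub] using this
  · rw [conj_diagonal_mul h1]
    congr 3
    ext i
    split_ifs <;> simp
  · rw [conj_diagonal_mul h1]
    congr 3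
    ext i
    split_ifs with h
    · simp [h.le]
    · simp [not_lt.1 h]

lemma exists_pseudoinverse {H : Matrix n n ℂ} (hH : H.IsHermitian) :
    ∃ K : Matrix n n ℂ, Kᴴ = K ∧ K * H = H * K ∧ K * H * H = H ∧ K * H * K = K := by
  obtain ⟨V, l, h1, -, rfl⟩ := exists_unitary_diagonal hH
  -- The convention `0⁻¹ = 0` makes this the inverse on the support and zero on the kernel.
  refine ⟨V * diagonal (fun i => (((l i)⁻¹ : ℝ) : ℂ)) * Vᴴ, conjTranspose_conj_diagonal _ _, ?_,
    ?_, ?_⟩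
  · simp only [conj_diagonal_mul h1]
    congr 3
    ext i
    exact mul_comm _ _
  all_goals
    simp only [conj_diagonal_mul h1]
    congr 3
    ext i
    by_cases h : l i = 0 <;> simp [h]

lemma one_sub_idempotent {Q : Matrix n n ℂ} (h : Qᴴ = Q) (h2 : Q * Q = Q) :
    (1 - Q)ᴴ = 1 - Q ∧ (1 - Q) * (1 - Q) = 1 - Q := by
  refine ⟨by simp [h], ?_⟩
  simp [Matrix.mul_sub, Matrix.sub_mul, h2]

lemma trace_mul_nonneg {A B : Matrix n n ℂ} (hA : A.PosSemidef) (hB : B.PosSemidef) :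
    0 ≤ (A * B).trace := by
  obtain ⟨C, rfl⟩ := CStarAlgebra.nonneg_iff_eq_star_mul_self.1 hA.nonneg
  rw [star_eq_conjTranspose, Matrix.mul_assoc, trace_mul_comm]
  exact (hB.mul_mul_conjTranspose_same C).trace_nonneg

lemma re_trace_mul_nonneg {A B : Matrix n n ℂ} (hA : A.PosSemidef) (hB : B.PosSemidef) :
    0 ≤ (A * B).trace.re :=
  (Complex.le_def.1 (trace_mul_nonneg hA hB)).1

/-- Cauchy–Schwarz for the Hilbert–Schmidt product of `P R U` and `P S`; the contraction `U` only
decreases the norm of the first factor. -/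
lemma norm_trace_contraction_le {R S P U : Matrix n n ℂ} (hR : Rᴴ = R) (hP : Pᴴ = P)
    (hP2 : P * P = P) (hU : (1 - U * Uᴴ).PosSemidef) (hS : Sᴴ = S) :
    ‖(Uᴴ * (R * P * S)).trace‖ ≤ √(P * (R * R)).trace.re * √(P * (S * S)).trace.re := by
  have h := norm_trace_conjTranspose_mul_le (P * R * U) (P * S)
  have e1 : (P * R * U)ᴴ * (P * S) = Uᴴ * (R * P * S) := by
    simp only [conjTranspose_mul, hR, hP, Matrix.mul_assoc]
    rw [← Matrix.mul_assoc P P, hP2]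
  have e2 : ((P * S)ᴴ * (P * S)).trace = (P * (S * S)).trace := by
    rw [trace_mul_comm]
    simp only [conjTranspose_mul, hS, hP]
    rw [← Matrix.mul_assoc, trace_mul_comm]
    simp only [← Matrix.mul_assoc, hP2]
  have e3 : ((P * R * U)ᴴ * (P * R * U)).trace.re ≤ (P * (R * R)).trace.re := by
    have h1 : 0 ≤ ((P * R * (1 - U * Uᴴ) * (P * R)ᴴ)).trace.re :=
      (Complex.le_def.1 (hU.mul_mul_conjTranspose_same (P * R)).trace_nonneg).1
    have h2 : (P * R * (P * R)ᴴ).trace = (P * (R * R)).trace := by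
      simp only [conjTranspose_mul, hR, hP]
      rw [← Matrix.mul_assoc, trace_mul_comm]
      simp only [← Matrix.mul_assoc, hP2]
    have h3 : ((P * R * U)ᴴ * (P * R * U)).trace = (P * R * (U * Uᴴ) * (P * R)ᴴ).trace := by
      rw [trace_mul_comm]
      simp only [conjTranspose_mul, Matrix.mul_assoc]
    rw [Matrix.mul_sub, Matrix.sub_mul, trace_sub, Matrix.mul_one, h2, Complex.sub_re, ← h3] at h1
    linarith
  rw [e1, e2] at h
  exact h.trans (by gcongr)

/-- Polar decomposition: with `K` the pseudoinverse of `|X|`, the matrix `U = X K` is a partial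
isometry, so `U Uᴴ` is a projection. -/
lemma exists_contraction_sqrt (X : Matrix n n ℂ) :
    ∃ U : Matrix n n ℂ, (1 - U * Uᴴ).PosSemidef ∧ CFC.sqrt (Xᴴ * X) = Uᴴ * X := by
  have hX : 0 ≤ Xᴴ * X := (posSemidef_conjTranspose_mul_self X).nonneg
  have hH2 : CFC.sqrt (Xᴴ * X) * CFC.sqrt (Xᴴ * X) = Xᴴ * X := CFC.sqrt_mul_sqrt_self _ hX
  have hH : (CFC.sqrt (Xᴴ * X)).PosSemidef := nonneg_iff_posSemidef.1 (CFC.sqrt_nonneg _)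
  generalize CFC.sqrt (Xᴴ * X) = H at hH hH2
  obtain ⟨K, hK, hKH, hKHH, hKHK⟩ := exists_pseudoinverse hH.isHermitian
  have hidem : K * K * (H * H) * (K * K) = K * K := by
    calc _ = K * (K * H * H) * (K * K) := by simp only [Matrix.mul_assoc]
      _ = K * (H * K) * K := by rw [hKHH]; simp only [Matrix.mul_assoc]
      _ = (K * (K * H)) * K := by rw [hKH]
      _ = K * (K * H * K) := by simp only [Matrix.mul_assoc]
      _ = K * K := by rw [hKHK]
  refine ⟨X * K, ?_, ?_⟩
  · have e : X * K * (X * K)ᴴ = X * (K * K) * Xᴴ := by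
      simp only [conjTranspose_mul, hK, Matrix.mul_assoc]
    rw [e]
    have h1 : (X * (K * K) * Xᴴ)ᴴ = X * (K * K) * Xᴴ := by
      simp only [conjTranspose_mul, conjTranspose_conjTranspose, hK, Matrix.mul_assoc]
    have h2 : X * (K * K) * Xᴴ * (X * (K * K) * Xᴴ) = X * (K * K) * Xᴴ := by
      calc _ = X * (K * K * (Xᴴ * X) * (K * K)) * Xᴴ := by simp only [Matrix.mul_assoc]
        _ = _ := by rw [← hH2, hidem]
    obtain ⟨h3, h4⟩ := one_sub_idempotent h1 h2
    exact posSemidef_of_idempotent h3 h4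
  · rw [conjTranspose_mul, hK, Matrix.mul_assoc, ← hH2, ← Matrix.mul_assoc, hKHH]

end Matrices

/-! ### Fidelity and binary projective measurements -/

section Fidelity

open Matrix

variable {V : Type} [Fintype V] [DecidableEq V]

/-- The square root of the fidelity does not decrease under a projective measurement. -/
lemma traceNorm_sqrt_mul_sqrt_le {ρ σ P : QMat V} (hρ : ρ.PosSemidef) (hσ : σ.PosSemidef)
    (hP : Pᴴ = P) (hP2 : P * P = P) :
    traceNorm (CFC.sqrt ρ * CFC.sqrt σ) ≤ √(P * ρ).trace.re * √(P * σ).trace.re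
      + √((1 - P) * ρ).trace.re * √((1 - P) * σ).trace.re := by
  obtain ⟨U, hU, hUX⟩ := exists_contraction_sqrt (CFC.sqrt ρ * CFC.sqrt σ)
  have h1 : CFC.sqrt ρ * CFC.sqrt ρ = ρ := CFC.sqrt_mul_sqrt_self _ hρ.nonneg
  have h2 : CFC.sqrt σ * CFC.sqrt σ = σ := CFC.sqrt_mul_sqrt_self _ hσ.nonneg
  have h3 : (CFC.sqrt ρ)ᴴ = CFC.sqrt ρ :=
    (nonneg_iff_posSemidef.1 (CFC.sqrt_nonneg ρ)).isHermitian
  have h4 : (CFC.sqrt σ)ᴴ = CFC.sqrt σ :=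
    (nonneg_iff_posSemidef.1 (CFC.sqrt_nonneg σ)).isHermitian
  obtain ⟨hQ, hQ2⟩ := one_sub_idempotent hP hP2
  have h5 := norm_trace_contraction_le h3 hP hP2 hU h4
  have h6 := norm_trace_contraction_le h3 hQ hQ2 hU h4
  rw [h1, h2] at h5 h6
  rw [traceNorm, hUX]
  -- The identity `P + (1 - P)` is inserted between the two square roots.
  have h7 : Uᴴ * (CFC.sqrt ρ * CFC.sqrt σ) = Uᴴ * (CFC.sqrt ρ * P * CFC.sqrt σ)
      + Uᴴ * (CFC.sqrt ρ * (1 - P) * CFC.sqrt σ) := by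
    simp only [Matrix.mul_sub, Matrix.sub_mul, Matrix.mul_one]
    abel
  rw [h7, trace_add, Complex.add_re]
  exact add_le_add ((Complex.re_le_norm _).trans h5) ((Complex.re_le_norm _).trans h6)

lemma traceNorm_nonneg (X : QMat V) : 0 ≤ traceNorm X :=
  (Complex.le_def.1 (nonneg_iff_posSemidef.1 (CFC.sqrt_nonneg (Xᴴ * X))).trace_nonneg).1

/-- The fidelity with a pure state. -/
lemma fidelity_vecMulVec_le {ρ : QMat V} (hρ : ρ.PosSemidef) {v : (V → Fin 2) → ℂ}
    (hv : star v ⬝ᵥ v = 1) :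
    fidelity ρ (vecMulVec v (star v)) ≤ (vecMulVec v (star v) * ρ).trace.re := by
  set P : QMat V := vecMulVec v (star v) with hPdef
  have hPs : P.PosSemidef := posSemidef_vecMulVec_self_star v
  have hP2 : P * P = P := by
    rw [hPdef, vecMulVec_mul_vecMulVec, hv, one_smul]
  have h := traceNorm_sqrt_mul_sqrt_le hρ hPs hPs.isHermitian hP2
  have hPt : P.trace = 1 := by rw [hPdef, trace_vecMulVec, dotProduct_comm, hv]
  -- Measuring the pure state with its own projector leaves no weight on `1 - P`, so the second
  -- summand drops out.
  rw [Matrix.sub_mul 1 P P, hP2, hPt, Matrix.one_mul, sub_self, trace_zero] at h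
  simp only [Complex.one_re, Real.sqrt_one, mul_one, Complex.zero_re, Real.sqrt_zero, mul_zero,
    add_zero] at h
  calc fidelity ρ P ≤ √(P * ρ).trace.re ^ 2 := by
        rw [fidelity]
        gcongr
        exact traceNorm_nonneg _
    _ = _ := Real.sq_sqrt (re_trace_mul_nonneg hPs hρ)

/-- With `(√p, √(1-p))` and `(√q, √(1-q))` as unit vectors at angles `θ` and `φ`, the overlap is
`cos (θ - φ)`, while `p - q = sin (φ - θ) sin (θ + φ)`. -/
lemma sq_le_one_sub_of_binary {p q : ℝ} (hp : 0 ≤ p) (hp1 : p ≤ 1) (hq : 0 ≤ q) (hq1 : q ≤ 1) :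
    (√p * √q + √(1 - p) * √(1 - q)) ^ 2 ≤ 1 - (p - q) ^ 2 := by
  have h1 := Real.sq_sqrt hp
  have h2 := Real.sq_sqrt hq
  have h3 := Real.sq_sqrt (sub_nonneg.2 hp1)
  have h4 := Real.sq_sqrt (sub_nonneg.2 hq1)
  generalize √p = a at *
  generalize √q = b at *
  generalize √(1 - p) = c at *
  generalize √(1 - q) = d at *
  have h5 : (a * b + c * d) ^ 2 + (a * d - b * c) ^ 2 = 1 := by
    have : (a * b + c * d) ^ 2 + (a * d - b * c) ^ 2 = (a ^ 2 + c ^ 2) * (b ^ 2 + d ^ 2) := by ring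
    rw [this, h1, h2, h3, h4]
    ring
  have h6 : (a * d + b * c) ^ 2 ≤ 1 := by
    have h : (a * d + b * c) ^ 2 + (a * b - c * d) ^ 2 = (a ^ 2 + c ^ 2) * (b ^ 2 + d ^ 2) := by
      ring
    rw [h1, h2, h3, h4] at h
    nlinarith [sq_nonneg (a * b - c * d)]
  have h7 : p - q = (a * d - b * c) * (a * d + b * c) := by
    have : (a * d - b * c) * (a * d + b * c) = a ^ 2 * d ^ 2 - b ^ 2 * c ^ 2 := by ring
    rw [this, h1, h2, h3, h4]
    ring
  rw [h7, mul_pow]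
  nlinarith [mul_nonneg (sq_nonneg (a * d - b * c)) (sub_nonneg.2 h6)]

/-- The Fuchs–van de Graaf inequality, in terms of the positive part of `ρ - σ`. -/
lemma exists_le_add_of_fidelity {ρ σ : QMat V} (hρ : IsState ρ) (hσ : IsState σ) {ε : ℝ}
    (h : 1 - fidelity ρ σ ≤ ε) :
    ∃ N : QMat V, N.PosSemidef ∧ N.trace = (√ε : ℝ) ∧ (σ + N - ρ).PosSemidef := by
  obtain ⟨N, P, hN, hNA, hP, hP2, hPA⟩ := exists_posPart (hρ.1.isHermitian.sub hσ.1.isHermitian)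
  obtain ⟨hQ, hQ2⟩ := one_sub_idempotent hP hP2
  have hPs := posSemidef_of_idempotent hP hP2
  have hQs := posSemidef_of_idempotent hQ hQ2
  have key := traceNorm_sqrt_mul_sqrt_le hρ.1 hσ.1 hP hP2
  have e (τ : QMat V) (hτ : IsState τ) : ((1 - P) * τ).trace.re = 1 - (P * τ).trace.re := by
    rw [Matrix.sub_mul, trace_sub, Matrix.one_mul, hτ.2]
    simp
  have hp := re_trace_mul_nonneg hPs hρ.1
  have hq := re_trace_mul_nonneg hPs hσ.1
  have hp1 := re_trace_mul_nonneg hQs hρ.1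
  have hq1 := re_trace_mul_nonneg hQs hσ.1
  rw [e ρ hρ] at key hp1
  rw [e σ hσ] at key hq1
  have hNt : N.trace.re = (P * ρ).trace.re - (P * σ).trace.re := by
    rw [← hPA, Matrix.mul_sub, trace_sub, Complex.sub_re]
  have hF : fidelity ρ σ ≤ 1 - N.trace.re ^ 2 := by
    rw [hNt]
    refine le_trans ?_ (sq_le_one_sub_of_binary hp (sub_nonneg.1 hp1) hq (sub_nonneg.1 hq1))
    rw [fidelity]
    gcongr
    exact traceNorm_nonneg _
  have hNs : N.trace.re ≤ √ε := Real.le_sqrt_of_sq_le (by linarith)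
  have hNtr : N.trace = (N.trace.re : ℂ) :=
    Complex.eq_re_of_ofReal_le (r := 0) (by simpa using hN.trace_nonneg)
  -- The positive part has trace at most `√ε`; a multiple of `ρ` raises it to exactly `√ε`, as the
  -- later normalization requires.
  refine ⟨N + (√ε - N.trace.re) • ρ, hN.add (hρ.1.smul (sub_nonneg.2 hNs)), ?_, ?_⟩
  · rw [trace_add, trace_smul, hρ.2, hNtr]
    simp
  · have := hNA.add (hρ.1.smul (sub_nonneg.2 hNs))
    convert this using 1
    abel

end Fidelity


/-! ### Cones generated by pure states -/

section Cones

open Matrix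

/-- The cone of the sums of the operators `|v⟩⟨v|`, `v ∈ S`. -/
def pureCone {n : Type*} (S : Set (n → ℂ)) : AddSubmonoid (Matrix n n ℂ) :=
  AddSubmonoid.closure ((fun v => vecMulVec v (star v)) '' S)

lemma vecMulVec_mem_pureCone {n : Type*} {S : Set (n → ℂ)} {v : n → ℂ} (hv : v ∈ S) :
    vecMulVec v (star v) ∈ pureCone S :=
  AddSubmonoid.subset_closure ⟨v, hv, rfl⟩

lemma mem_pureCone_univ_iff {n : Type*} [Finite n] {X : Matrix n n ℂ} :
    X ∈ pureCone Set.univ ↔ X.PosSemidef := by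
  constructor
  · intro h
    induction h using AddSubmonoid.closure_induction with
    | mem x hx =>
      obtain ⟨v, -, rfl⟩ := hx
      exact posSemidef_vecMulVec_self_star v
    | zero => exact PosSemidef.zero
    | add x y _ _ hx hy => exact hx.add hy
  · intro h
    obtain ⟨m, v, rfl⟩ := posSemidef_iff_eq_sum_vecMulVec.1 h
    exact sum_mem fun i _ => vecMulVec_mem_pureCone (Set.mem_univ _)

lemma posSemidef_of_mem_pureCone {n : Type*} [Finite n] {S : Set (n → ℂ)} {X : Matrix n n ℂ}
    (h : X ∈ pureCone S) : X.PosSemidef :=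
  mem_pureCone_univ_iff.1
    (AddSubmonoid.closure_mono (Set.image_mono (Set.subset_univ S)) h)

lemma map_mem_of_mem_pureCone {V W : Type} {L : QMat V → QMat W}
    {S' : Set ((V → Fin 2) → ℂ)} {C : AddSubmonoid (QMat W)}
    (hL : IsLinearMap ℂ L) (h : ∀ v ∈ S', L (vecMulVec v (star v)) ∈ C) {X : QMat V}
    (hX : X ∈ pureCone S') : L X ∈ C := by
  induction hX using AddSubmonoid.closure_induction with
  | mem x hx =>
    obtain ⟨v, hv, rfl⟩ := hx
    exact h v hv
  | zero => rw [hL.map_zero]; exact C.zero_mem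
  | add x y _ _ hx hy => rw [hL.map_add]; exact C.add_mem hx hy

/-- Trace preserving linear maps that map pure states to mixtures of pure states, and those in `S`
to mixtures of pure states in `T`. -/
structure IsFreeMap {V W : Type} [Fintype V] [DecidableEq V] [Fintype W] [DecidableEq W]
    (S : Set ((V → Fin 2) → ℂ)) (T : Set ((W → Fin 2) → ℂ)) (L : QMat V → QMat W) : Prop where
  isLinear : IsLinearMap ℂ L
  trace_map : ∀ X, (L X).trace = X.trace
  map_pure : ∀ v, L (vecMulVec v (star v)) ∈ pureCone Set.univ
  map_pure_of_mem : ∀ v ∈ S, L (vecMulVec v (star v)) ∈ pureCone T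

namespace IsFreeMap

variable {V W Z : Type} [Fintype V] [DecidableEq V] [Fintype W] [DecidableEq W] [Fintype Z]
  [DecidableEq Z] {S : Set ((V → Fin 2) → ℂ)} {T : Set ((W → Fin 2) → ℂ)}
  {R : Set ((Z → Fin 2) → ℂ)} {L : QMat V → QMat W} {M : QMat W → QMat Z}

lemma map_mem (h : IsFreeMap S T L) {X : QMat V} (hX : X ∈ pureCone S) : L X ∈ pureCone T :=
  map_mem_of_mem_pureCone h.isLinear h.map_pure_of_mem hX

lemma map_posSemidef (h : IsFreeMap S T L) {X : QMat V} (hX : X.PosSemidef) :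
    (L X).PosSemidef :=
  mem_pureCone_univ_iff.1
    (map_mem_of_mem_pureCone h.isLinear (fun v _ => h.map_pure v) (mem_pureCone_univ_iff.2 hX))

lemma map_isState (h : IsFreeMap S T L) {X : QMat V} (hX : IsState X) : IsState (L X) :=
  ⟨h.map_posSemidef hX.1, (h.trace_map X).trans hX.2⟩

lemma id : IsFreeMap S S (fun X => X) :=
  ⟨⟨fun _ _ => rfl, fun _ _ => rfl⟩, fun _ => rfl,
    fun _ => vecMulVec_mem_pureCone (Set.mem_univ _), fun _ => vecMulVec_mem_pureCone⟩

lemma comp (hM : IsFreeMap T R M) (hL : IsFreeMap S T L) : IsFreeMap S R (fun X => M (L X)) where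
  isLinear := ⟨fun X Y => by rw [hL.isLinear.map_add, hM.isLinear.map_add],
    fun c X => by rw [hL.isLinear.map_smul, hM.isLinear.map_smul]⟩
  trace_map X := by rw [hM.trace_map, hL.trace_map]
  map_pure v := by
    rw [mem_pureCone_univ_iff]
    exact hM.map_posSemidef (hL.map_posSemidef (posSemidef_vecMulVec_self_star v))
  map_pure_of_mem v hv := hM.map_mem (hL.map_pure_of_mem v hv)

end IsFreeMap

end Cones

/-! ### Operators on a sub-register -/

section Registers

open Matrix

variable {V W : Type}

/-- The strings that agree with `x` off the sub-register are exactly the `Function.extend e v x`,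
one for each `v`. -/
lemma sum_ite_eq_off_range [Fintype V] [DecidableEq V] [Fintype W] [DecidableEq W]
    {M : Type*} [AddCommMonoid M] (e : V ↪ W)
    (x : W → Fin 2) (F : (W → Fin 2) → M) {p : (W → Fin 2) → Prop} [DecidablePred p]
    (hp : ∀ z, p z ↔ ∀ w, w ∉ Set.range e → x w = z w) :
    ∑ z, (if p z then F z else 0) = ∑ v : V → Fin 2, F (Function.extend e v x) := by
  rw [← Finset.sum_filter]
  refine Finset.sum_nbij' (fun z v => z (e v)) (fun v => Function.extend e v x) ?_ ?_ ?_ ?_ ?_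
  · simp
  · intro v _
    simp only [Finset.mem_filter, Finset.mem_univ, true_and, hp]
    intro w hw
    rw [Function.extend_apply' _ _ _ (by simpa using hw)]
  · intro z hz
    simp only [Finset.mem_filter, Finset.mem_univ, true_and, hp] at hz
    funext w
    by_cases hw : w ∈ Set.range e
    · obtain ⟨v, rfl⟩ := hw
      rw [e.injective.extend_apply]
    · rw [Function.extend_apply' _ _ _ (by simpa using hw), hz w hw]
  · intro v _
    funext i
    exact e.injective.extend_apply _ _ _
  · intro z hz
    simp only [Finset.mem_filter, Finset.mem_univ, true_and, hp] at hz
    congr 1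
    funext w
    by_cases hw : w ∈ Set.range e
    · obtain ⟨v, rfl⟩ := hw
      rw [e.injective.extend_apply]
    · rw [Function.extend_apply' _ _ _ (by simpa using hw), hz w hw]

/-- The operator `U` on the sub-register `V` of `W`, tensored with the identity. -/
def embedOp (e : V ↪ W) (U : QMat V) : QMat W :=
  open Classical in
  fun x y => if ∀ w, w ∉ Set.range e → x w = y w
    then U (fun i => x (e i)) (fun i => y (e i)) else 0

lemma extend_off_range_iff (e : V ↪ W) (v : V → Fin 2) (x y : W → Fin 2) :
    (∀ w, w ∉ Set.range e → Function.extend e v x w = y w) ↔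
      ∀ w, w ∉ Set.range e → x w = y w := by
  refine forall₂_congr fun w hw => ?_
  rw [Function.extend_apply' _ _ _ (by simpa using hw)]

lemma embedOp_mul [Fintype V] [DecidableEq V] [Fintype W] [DecidableEq W] (e : V ↪ W)
    (A B : QMat V) : embedOp e (A * B) = embedOp e A * embedOp e B := by
  classical
  ext x y
  simp only [mul_apply, embedOp, ite_mul, zero_mul]
  rw [sum_ite_eq_off_range e x _ fun z => Iff.rfl]
  simp only [extend_off_range_iff, e.injective.extend_apply]
  split_ifs <;> simp

lemma embedOp_one [Fintype V] [DecidableEq V] [Fintype W] [DecidableEq W] (e : V ↪ W) :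
    embedOp e (1 : QMat V) = 1 := by
  classical
  ext x y
  simp only [embedOp, one_apply, ← ite_and]
  refine if_congr ?_ rfl rfl
  constructor
  · rintro ⟨h1, h2⟩
    funext w
    by_cases hw : w ∈ Set.range e
    · obtain ⟨v, rfl⟩ := hw
      exact congrFun h2 v
    · exact h1 w hw
  · rintro rfl
    simp

lemma embedOp_trans {Z : Type} (f : Z ↪ V) (e : V ↪ W) (U : QMat Z) :
    embedOp (f.trans e) U = embedOp e (embedOp f U) := by
  classical
  ext x y
  simp only [embedOp, ← ite_and]
  refine if_congr ?_ rfl rfl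
  constructor
  · intro h
    refine ⟨fun w hw => h w ?_, fun v hv => h (e v) ?_⟩
    · rintro ⟨z, rfl⟩
      exact hw ⟨f z, rfl⟩
    · rintro ⟨z, hz⟩
      exact hv ⟨z, e.injective hz⟩
  · rintro ⟨h1, h2⟩ w hw
    by_cases hw' : w ∈ Set.range e
    · obtain ⟨v, rfl⟩ := hw'
      exact h2 v fun ⟨z, hz⟩ => hw ⟨z, congrArg e hz⟩
    · exact h1 w hw'

lemma embedOp_conjTranspose (e : V ↪ W) (U : QMat V) : embedOp e Uᴴ = (embedOp e U)ᴴ := by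
  classical
  ext x y
  simp only [embedOp, conjTranspose_apply]
  have h : (∀ w, w ∉ Set.range e → y w = x w) ↔ ∀ w, w ∉ Set.range e → x w = y w :=
    forall₂_congr fun w _ => eq_comm
  simp only [h]
  split_ifs <;> simp

lemma embedOp_mulVec [Fintype V] [DecidableEq V] [Fintype W] [DecidableEq W] (e : V ↪ W)
    (U : QMat V) (ψ : (W → Fin 2) → ℂ) (x : W → Fin 2) :
    (embedOp e U *ᵥ ψ) x = ∑ v, U (fun i => x (e i)) v * ψ (Function.extend e v x) := by
  classical
  simp only [mulVec, dotProduct, embedOp, ite_mul, zero_mul]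
  rw [sum_ite_eq_off_range e x _ fun z => Iff.rfl]
  simp only [e.injective.extend_apply]

lemma Circuit.toMat_embed {G : GateSet} [Fintype V] [DecidableEq V] [Fintype W] [DecidableEq W]
    (e : V ↪ W) (C : Circuit G V) :
    Circuit.toMat (Circuit.embed e C) = embedOp e (Circuit.toMat C) := by
  induction C with
  | nil => exact (embedOp_one e).symm
  | cons g C ih =>
    -- `applyGate` and `embedOp` have the same body, so the gates can be rewritten as embedded
    -- operators definitionally.
    change Circuit.toMat (Circuit.embed e C) * embedOp (g.2.trans e) (G.mat g.1) =
      embedOp e (Circuit.toMat C * embedOp g.2 (G.mat g.1))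
    rw [ih, embedOp_mul, embedOp_trans]

lemma Circuit.conjTranspose_toMat_mul_toMat {G : GateSet} [Fintype W] [DecidableEq W]
    (C : Circuit G W) : (Circuit.toMat C)ᴴ * Circuit.toMat C = 1 := by
  induction C with
  | nil => simp [Circuit.toMat]
  | cons g C ih =>
    change (Circuit.toMat C * embedOp g.2 (G.mat g.1))ᴴ *
      (Circuit.toMat C * embedOp g.2 (G.mat g.1)) = 1
    have hU : (G.mat g.1)ᴴ * G.mat g.1 = 1 := (mem_unitaryGroup_iff').1 (G.unitary g.1)
    calc _ = (embedOp g.2 (G.mat g.1))ᴴ * ((Circuit.toMat C)ᴴ * Circuit.toMat C) *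
          embedOp g.2 (G.mat g.1) := by simp only [conjTranspose_mul, Matrix.mul_assoc]
      _ = 1 := by rw [ih, Matrix.mul_one, ← embedOp_conjTranspose, ← embedOp_mul, hU, embedOp_one]

/-! ### Ancillas, measurements and partial traces -/

/-- The part of a vector on which the sub-register `V` is in the basis state `c`. -/
def restrictTo [DecidableEq (V → Fin 2)] (e : V ↪ W) (c : V → Fin 2) (v : (W → Fin 2) → ℂ) :
    (W → Fin 2) → ℂ :=
  fun x => if (fun i => x (e i)) = c then v x else 0

lemma measureReg_vecMulVec [Fintype V] [DecidableEq V] (e : V ↪ W) (v : (W → Fin 2) → ℂ) :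
    measureReg e (vecMulVec v (star v)) =
      ∑ c, vecMulVec (restrictTo e c v) (star (restrictTo e c v)) := by
  ext x y
  rw [Matrix.sum_apply]
  simp only [measureReg, vecMulVec_apply, restrictTo, Pi.star_apply, ite_mul, zero_mul]
  rw [Finset.sum_ite_eq, if_pos (Finset.mem_univ _)]
  by_cases h : ∀ i, x (e i) = y (e i)
  · rw [if_pos h, if_pos (funext fun i => (h i).symm)]
  · rw [if_neg h, if_neg fun h' => h fun i => (congrFun h' i).symm, star_zero, mul_zero]

lemma isLinearMap_measureReg (e : V ↪ W) : IsLinearMap ℂ (measureReg e) := by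
  constructor <;> intros <;> ext x y <;> simp only [measureReg, Matrix.add_apply, Matrix.smul_apply] <;>
    split_ifs <;> simp

lemma trace_measureReg [Fintype W] [DecidableEq W] (e : V ↪ W) (X : QMat W) :
    (measureReg e X).trace = X.trace := by
  simp [trace, measureReg]

lemma isFreeMap_measureReg [Fintype V] [DecidableEq V] [Fintype W] [DecidableEq W] (e : V ↪ W)
    {S T : Set ((W → Fin 2) → ℂ)} (h : ∀ v ∈ S, ∀ c, restrictTo e c v ∈ T) :
    IsFreeMap S T (measureReg e) where
  isLinear := isLinearMap_measureReg e
  trace_map := trace_measureReg e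
  map_pure v := by
    rw [measureReg_vecMulVec]
    exact sum_mem fun c _ => vecMulVec_mem_pureCone (Set.mem_univ _)
  map_pure_of_mem v hv := by
    rw [measureReg_vecMulVec]
    exact sum_mem fun c _ => vecMulVec_mem_pureCone (h v hv c)

lemma isLinearMap_addAncillas (e : V ↪ W) : IsLinearMap ℂ (addAncillas e) := by
  constructor <;> intros <;> ext x y <;> simp only [addAncillas, Matrix.add_apply, Matrix.smul_apply] <;>
    split_ifs <;> simp

/-- The vector `v` on the sub-register `V`, all other qubits being `|0⟩`. -/
def addAncillasVec (e : V ↪ W) (v : (V → Fin 2) → ℂ) : (W → Fin 2) → ℂ :=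
  open Classical in
  fun x => if ∀ w, w ∉ Set.range e → x w = 0 then v (fun i => x (e i)) else 0

lemma addAncillas_vecMulVec (e : V ↪ W) (v : (V → Fin 2) → ℂ) :
    addAncillas e (vecMulVec v (star v)) =
      vecMulVec (addAncillasVec e v) (star (addAncillasVec e v)) := by
  ext x y
  have h : (∀ w, w ∉ Set.range e → x w = 0 ∧ y w = 0) ↔
      (∀ w, w ∉ Set.range e → x w = 0) ∧ ∀ w, w ∉ Set.range e → y w = 0 :=
    ⟨fun h => ⟨fun w hw => (h w hw).1, fun w hw => (h w hw).2⟩, fun h w hw => ⟨h.1 w hw, h.2 w hw⟩⟩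
  simp only [addAncillas, vecMulVec_apply, addAncillasVec, Pi.star_apply]
  by_cases h1 : ∀ w, w ∉ Set.range e → x w = 0
  · by_cases h2 : ∀ w, w ∉ Set.range e → y w = 0
    · rw [if_pos (h.2 ⟨h1, h2⟩), if_pos h1, if_pos h2]
    · rw [if_neg fun h' => h2 (h.1 h').2, if_neg h2, star_zero, mul_zero]
  · rw [if_neg fun h' => h1 (h.1 h').1, if_neg h1, zero_mul]

lemma trace_addAncillas [Fintype V] [DecidableEq V] [Fintype W] [DecidableEq W] (e : V ↪ W)
    (X : QMat V) : (addAncillas e X).trace = X.trace := by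
  classical
  have h := sum_ite_eq_off_range (p := fun z => ∀ w, w ∉ Set.range e → z w = 0 ∧ z w = 0) e
    (fun _ => 0) (fun z => X (fun v => z (e v)) (fun v => z (e v))) fun z => by simp [eq_comm]
  simp only [e.injective.extend_apply] at h
  refine Eq.trans (Finset.sum_congr rfl fun z _ => ?_) h
  simp only [diag, addAncillas]
  congr

lemma isFreeMap_addAncillas [Fintype V] [DecidableEq V] [Fintype W] [DecidableEq W] (e : V ↪ W)
    {S : Set ((V → Fin 2) → ℂ)} {T : Set ((W → Fin 2) → ℂ)} (h : ∀ v ∈ S, addAncillasVec e v ∈ T) :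
    IsFreeMap S T (addAncillas e) where
  isLinear := isLinearMap_addAncillas e
  trace_map := trace_addAncillas e
  map_pure v := by
    rw [addAncillas_vecMulVec]
    exact vecMulVec_mem_pureCone (Set.mem_univ _)
  map_pure_of_mem v hv := by
    rw [addAncillas_vecMulVec]
    exact vecMulVec_mem_pureCone (h v hv)

lemma isFreeMap_conj [Fintype W] [DecidableEq W] {U : QMat W} (hU : Uᴴ * U = 1)
    {S T : Set ((W → Fin 2) → ℂ)} (h : ∀ v ∈ S, U *ᵥ v ∈ T) :
    IsFreeMap S T (fun X => U * X * Uᴴ) := by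
  have hv (v : (W → Fin 2) → ℂ) :
      U * vecMulVec v (star v) * Uᴴ = vecMulVec (U *ᵥ v) (star (U *ᵥ v)) := by
    rw [mul_vecMulVec, vecMulVec_mul, star_mulVec]
  refine ⟨⟨fun X Y => by rw [Matrix.mul_add, Matrix.add_mul], fun c X => by simp⟩, fun X => ?_,
    fun v => ?_, fun v hvS => ?_⟩
  · rw [Matrix.mul_assoc, trace_mul_comm, Matrix.mul_assoc, hU, Matrix.mul_one]
  · rw [hv]
    exact vecMulVec_mem_pureCone (Set.mem_univ _)
  · rw [hv]
    exact vecMulVec_mem_pureCone (h v hvS)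

lemma isLinearMap_reduceTo [Fintype W] [DecidableEq W] (e : V ↪ W) :
    IsLinearMap ℂ (reduceTo (V := V) e) := by
  constructor
  · intro A B
    ext x y
    simp only [reduceTo, Matrix.add_apply, ← Finset.sum_add_distrib]
    refine Finset.sum_congr rfl fun z _ => Finset.sum_congr rfl fun z' _ => ?_
    split_ifs <;> simp
  · intro c A
    ext x y
    simp only [reduceTo, Matrix.smul_apply, Finset.smul_sum]
    refine Finset.sum_congr rfl fun z _ => Finset.sum_congr rfl fun z' _ => ?_
    split_ifs <;> simp

lemma reduceTo_apply' [Fintype V] [DecidableEq V] [Fintype W] [DecidableEq W] (e : V ↪ W)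
    (X : QMat W) (x y : V → Fin 2) :
    reduceTo e X x y =
      ∑ z : W → Fin 2, if (fun i => z (e i)) = x then X z (Function.extend e y z) else 0 := by
  classical
  rw [reduceTo]
  refine Finset.sum_congr rfl fun z _ => ?_
  by_cases h : (fun i => z (e i)) = x
  · have h' : ∀ v, z (e v) = x v := congrFun h
    simp only [h', implies_true, true_and, if_true]
    calc _ = ∑ z' : W → Fin 2, if (∀ w, w ∉ Set.range e → z w = z' w) then
          (if ∀ v, z' (e v) = y v then X z z' else 0) else 0 := by
            refine Finset.sum_congr rfl fun z' _ => ?_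
            rw [← ite_and]
            exact if_congr and_comm rfl rfl
      _ = X z (Function.extend e y z) := by
        rw [sum_ite_eq_off_range e z _ fun z => Iff.rfl]
        simp only [e.injective.extend_apply, ← funext_iff, Finset.sum_ite_eq', Finset.mem_univ,
          if_true]
  · have h' : ¬ ∀ v, z (e v) = x v := fun h' => h (funext h')
    simp [h, h']

lemma trace_reduceTo [Fintype V] [DecidableEq V] [Fintype W] [DecidableEq W] (e : V ↪ W)
    (X : QMat W) : (reduceTo e X).trace = X.trace := by
  simp only [trace, diag, reduceTo_apply']
  rw [Finset.sum_comm]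
  refine Finset.sum_congr rfl fun z _ => ?_
  rw [Finset.sum_ite_eq, if_pos (Finset.mem_univ _)]
  congr 1
  funext w
  by_cases hw : w ∈ Set.range e
  · obtain ⟨v, rfl⟩ := hw
    rw [e.injective.extend_apply]
  · rw [Function.extend_apply' _ _ _ (by simpa using hw)]

lemma extend_extend (e : V ↪ W) (x y : V → Fin 2) (z : W → Fin 2) :
    Function.extend e y (Function.extend e x z) = Function.extend e y z := by
  funext w
  by_cases hw : w ∈ Set.range e
  · obtain ⟨v, rfl⟩ := hw
    rw [e.injective.extend_apply, e.injective.extend_apply]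
  · rw [Function.extend_apply' _ _ _ (by simpa using hw),
      Function.extend_apply' _ _ _ (by simpa using hw),
      Function.extend_apply' _ _ _ (by simpa using hw)]

lemma extend_self (e : V ↪ W) (z : W → Fin 2) : Function.extend e (fun i => z (e i)) z = z := by
  funext w
  by_cases hw : w ∈ Set.range e
  · obtain ⟨v, rfl⟩ := hw
    rw [e.injective.extend_apply]
  · rw [Function.extend_apply' _ _ _ (by simpa using hw)]

/-- The environment is indexed by full strings `u` that vanish on `V`, which avoids a type for the
complement. In this symmetric form each `u` yields one Kraus operator. -/
lemma reduceTo_apply [Fintype V] [DecidableEq V] [Fintype W] [DecidableEq W] (e : V ↪ W)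
    (X : QMat W) (x y : V → Fin 2) :
    reduceTo e X x y = ∑ u : W → Fin 2, if (fun i => u (e i)) = 0 then
      X (Function.extend e x u) (Function.extend e y u) else 0 := by
  rw [reduceTo_apply', ← Finset.sum_filter, ← Finset.sum_filter]
  refine Finset.sum_nbij' (fun z => Function.extend e 0 z) (fun u => Function.extend e x u)
    ?_ ?_ ?_ ?_ ?_
  · intro z _
    simp only [Finset.mem_filter, Finset.mem_univ, true_and, e.injective.extend_apply]
  · intro u _
    simp only [Finset.mem_filter, Finset.mem_univ, true_and, e.injective.extend_apply]
  · intro z hz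
    simp only [Finset.mem_filter, Finset.mem_univ, true_and] at hz
    rw [extend_extend, ← hz, extend_self]
  · intro u hu
    simp only [Finset.mem_filter, Finset.mem_univ, true_and] at hu
    rw [extend_extend, ← hu, extend_self]
  · intro z hz
    simp only [Finset.mem_filter, Finset.mem_univ, true_and] at hz
    rw [extend_extend, extend_extend]
    congr 1
    rw [← hz, extend_self]

/-- The vector on the sub-register `V` conditioned on the other qubits being in the state `u`. -/
def sliceVec [DecidableEq (V → Fin 2)] (e : V ↪ W) (u : W → Fin 2) (v : (W → Fin 2) → ℂ) :
    (V → Fin 2) → ℂ :=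
  fun x => if (fun i => u (e i)) = 0 then v (Function.extend e x u) else 0

lemma reduceTo_vecMulVec [Fintype V] [DecidableEq V] [Fintype W] [DecidableEq W] (e : V ↪ W)
    (v : (W → Fin 2) → ℂ) : reduceTo e (vecMulVec v (star v)) =
      ∑ u, vecMulVec (sliceVec e u v) (star (sliceVec e u v)) := by
  ext x y
  rw [Matrix.sum_apply, reduceTo_apply]
  refine Finset.sum_congr rfl fun u _ => ?_
  simp only [vecMulVec_apply, sliceVec, Pi.star_apply]
  split_ifs <;> simp

lemma isFreeMap_reduceTo [Fintype V] [DecidableEq V] [Fintype W] [DecidableEq W] (e : V ↪ W)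
    {S : Set ((W → Fin 2) → ℂ)} {T : Set ((V → Fin 2) → ℂ)} (h : ∀ v ∈ S, ∀ u, sliceVec e u v ∈ T) :
    IsFreeMap S T (reduceTo e) where
  isLinear := isLinearMap_reduceTo e
  trace_map := trace_reduceTo e
  map_pure v := by
    rw [reduceTo_vecMulVec]
    exact sum_mem fun c _ => vecMulVec_mem_pureCone (Set.mem_univ _)
  map_pure_of_mem v hv := by
    rw [reduceTo_vecMulVec]
    exact sum_mem fun c _ => vecMulVec_mem_pureCone (h v hv c)

end Registers

/-! ### Product vectors and LOCC maps -/

section Product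

open Matrix

/-- The product vectors `α ⊗ β`. -/
def productVectors (V W : Type) : Set ((V ⊕ W → Fin 2) → ℂ) :=
  {v | ∃ (α : (V → Fin 2) → ℂ) (β : (W → Fin 2) → ℂ),
    v = fun x => α (fun i => x (.inl i)) * β (fun i => x (.inr i))}

/-- The product vectors `α ⊗ β ⊗ |c⟩`. -/
def productVectorsWith (P Q R : Type) [DecidableEq (R → Fin 2)] :
    Set (((P ⊕ Q) ⊕ R → Fin 2) → ℂ) :=
  {v | ∃ (α : (P → Fin 2) → ℂ) (β : (Q → Fin 2) → ℂ) (c : R → Fin 2),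
    v = fun x => if (fun i => x (.inr i)) = c then
      α (fun i => x (.inl (.inl i))) * β (fun i => x (.inl (.inr i))) else 0}

variable {P Q R V W : Type}

/-- Alice's circuit may entangle her qubits with `C`, but `C` enters in the basis state `c₀` and is
projected onto `c`. The net effect is the operator `⟨c|U|c₀⟩` on her factor alone, with `β`
untouched. -/
lemma restrictTo_embedOp_inl_mem [Fintype P] [DecidableEq P] [Fintype Q] [DecidableEq Q]
    [Fintype R] [DecidableEq R] (e : P ⊕ R ↪ (P ⊕ Q) ⊕ R) (heP : ∀ i, e (.inl i) = .inl (.inl i))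
    (heR : ∀ i, e (.inr i) = .inr i) (U : QMat (P ⊕ R)) {v : ((P ⊕ Q) ⊕ R → Fin 2) → ℂ}
    (hv : v ∈ productVectorsWith P Q R) (c : R → Fin 2) :
    restrictTo Function.Embedding.inr c (embedOp e U *ᵥ v) ∈ productVectorsWith P Q R := by
  obtain ⟨α, β, c₀, rfl⟩ := hv
  refine ⟨fun a => ∑ u : P ⊕ R → Fin 2, U (Sum.elim a c) u *
    (if (fun i => u (.inr i)) = c₀ then α (fun i => u (.inl i)) else 0), β, c, ?_⟩
  funext x
  have h1 (u : P ⊕ R → Fin 2) (i) : Function.extend e u x (.inl (.inl i)) = u (.inl i) := by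
    rw [← heP, e.injective.extend_apply]
  have h2 (u : P ⊕ R → Fin 2) (i) : Function.extend e u x (.inr i) = u (.inr i) := by
    rw [← heR, e.injective.extend_apply]
  have h3 (u : P ⊕ R → Fin 2) (i) : Function.extend e u x (.inl (.inr i)) = x (.inl (.inr i)) := by
    rw [Function.extend_apply']
    rintro ⟨p | r, h⟩
    · rw [heP] at h; cases h
    · rw [heR] at h; cases h
  simp only [restrictTo, Function.Embedding.inr_apply]
  refine if_ctx_congr Iff.rfl (fun hc => ?_) fun _ => rfl
  have hx : (fun i => x (e i)) = Sum.elim (fun i => x (.inl (.inl i))) c := by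
    funext i
    rcases i with i | i
    · simp [heP]
    · simp [heR, ← hc]
  rw [embedOp_mulVec, Finset.sum_mul, hx]
  refine Finset.sum_congr rfl fun u _ => ?_
  simp only [h1, h2, h3]
  split_ifs <;> simp [mul_assoc]

lemma restrictTo_embedOp_inr_mem [Fintype P] [DecidableEq P] [Fintype Q] [DecidableEq Q]
    [Fintype R] [DecidableEq R] (e : Q ⊕ R ↪ (P ⊕ Q) ⊕ R) (heQ : ∀ i, e (.inl i) = .inl (.inr i))
    (heR : ∀ i, e (.inr i) = .inr i) (U : QMat (Q ⊕ R)) {v : ((P ⊕ Q) ⊕ R → Fin 2) → ℂ}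
    (hv : v ∈ productVectorsWith P Q R) (c : R → Fin 2) :
    restrictTo Function.Embedding.inr c (embedOp e U *ᵥ v) ∈ productVectorsWith P Q R := by
  obtain ⟨α, β, c₀, rfl⟩ := hv
  refine ⟨α, fun b => ∑ u : Q ⊕ R → Fin 2, U (Sum.elim b c) u *
    (if (fun i => u (.inr i)) = c₀ then β (fun i => u (.inl i)) else 0), c, ?_⟩
  funext x
  have h1 (u : Q ⊕ R → Fin 2) (i) : Function.extend e u x (.inl (.inr i)) = u (.inl i) := by
    rw [← heQ, e.injective.extend_apply]
  have h2 (u : Q ⊕ R → Fin 2) (i) : Function.extend e u x (.inr i) = u (.inr i) := by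
    rw [← heR, e.injective.extend_apply]
  have h3 (u : Q ⊕ R → Fin 2) (i) : Function.extend e u x (.inl (.inl i)) = x (.inl (.inl i)) := by
    rw [Function.extend_apply']
    rintro ⟨p | r, h⟩
    · rw [heQ] at h; cases h
    · rw [heR] at h; cases h
  simp only [restrictTo, Function.Embedding.inr_apply]
  refine if_ctx_congr Iff.rfl (fun hc => ?_) fun _ => rfl
  have hx : (fun i => x (e i)) = Sum.elim (fun i => x (.inl (.inr i))) c := by
    funext i
    rcases i with i | i
    · simp [heQ]
    · simp [heR, ← hc]
  rw [embedOp_mulVec, Finset.mul_sum, hx]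
  refine Finset.sum_congr rfl fun u _ => ?_
  simp only [h1, h2, h3]
  split_ifs <;> simp [mul_left_comm]

namespace LOCC

variable {G : GateSet} {nA nB mA mB : ℕ} (Γ : LOCC G nA nB mA mB)

/-- The vectors `α ⊗ β ⊗ |c⟩` on all the qubits of an LOCC map. -/
abbrev prodVec : Set ((Γ.Reg → Fin 2) → ℂ) :=
  productVectorsWith (Fin nA ⊕ Fin Γ.tA) (Fin nB ⊕ Fin Γ.tB) (Fin Γ.c)

lemma isFreeMap_halfRound (C : Circuit G Γ.Reg)
    (h : ∀ v ∈ Γ.prodVec, ∀ c, restrictTo Γ.regC c (Circuit.toMat C *ᵥ v) ∈ Γ.prodVec) :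
    IsFreeMap Γ.prodVec Γ.prodVec (Γ.halfRound C) :=
  -- Between circuit and measurement the vector need not be a product; the intermediate class asks
  -- only that every projection on a value of `C` is one.
  (isFreeMap_measureReg Γ.regC (S := {w | ∀ c, restrictTo Γ.regC c w ∈ Γ.prodVec})
    fun _ hw c => hw c).comp
    (isFreeMap_conj (Circuit.conjTranspose_toMat_mul_toMat C) fun v hv c => h v hv c)

lemma isFreeMap_round
    (R : Circuit G ((Fin nA ⊕ Fin Γ.tA) ⊕ Fin Γ.c) × Circuit G ((Fin nB ⊕ Fin Γ.tB) ⊕ Fin Γ.c)) :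
    IsFreeMap Γ.prodVec Γ.prodVec (fun X => Γ.round X R) := by
  refine (Γ.isFreeMap_halfRound _ fun v hv c => ?_).comp
    (Γ.isFreeMap_halfRound _ fun v hv c => ?_)
  · rw [Circuit.toMat_embed]
    exact restrictTo_embedOp_inr_mem Γ.regB (fun _ => rfl) (fun _ => rfl) _ hv c
  · rw [Circuit.toMat_embed]
    exact restrictTo_embedOp_inl_mem Γ.regA (fun _ => rfl) (fun _ => rfl) _ hv c

lemma isFreeMap_foldl
    (l : List (Circuit G ((Fin nA ⊕ Fin Γ.tA) ⊕ Fin Γ.c) ×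
      Circuit G ((Fin nB ⊕ Fin Γ.tB) ⊕ Fin Γ.c))) :
    IsFreeMap Γ.prodVec Γ.prodVec (fun X => l.foldl Γ.round X) := by
  induction l with
  | nil => exact IsFreeMap.id
  | cons R l ih => exact ih.comp (Γ.isFreeMap_round R)

lemma addAncillasVec_mem {v : (Fin nA ⊕ Fin nB → Fin 2) → ℂ}
    (hv : v ∈ productVectors (Fin nA) (Fin nB)) : addAncillasVec Γ.regIn v ∈ Γ.prodVec := by
  classical
  obtain ⟨α, β, rfl⟩ := hv
  refine ⟨addAncillasVec Function.Embedding.inl α, addAncillasVec Function.Embedding.inl β, 0, ?_⟩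
  funext x
  have h : (∀ w, w ∉ Set.range Γ.regIn → x w = 0) ↔ ((fun i => x (.inr i)) = 0 ∧
      (∀ w, w ∉ Set.range (Function.Embedding.inl : Fin nA ↪ Fin nA ⊕ Fin Γ.tA) →
        x (.inl (.inl w)) = 0) ∧
      (∀ w, w ∉ Set.range (Function.Embedding.inl : Fin nB ↪ Fin nB ⊕ Fin Γ.tB) →
        x (.inl (.inr w)) = 0)) := by
    constructor
    · intro h
      refine ⟨funext fun i => h _ ?_, fun w hw => h _ ?_, fun w hw => h _ ?_⟩
      · rintro ⟨a | b, hab⟩ <;> cases hab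
      · rintro ⟨a | b, hab⟩
        · cases hab; exact hw ⟨a, rfl⟩
        · cases hab
      · rintro ⟨a | b, hab⟩
        · cases hab
        · cases hab; exact hw ⟨b, rfl⟩
    · rintro ⟨h1, h2, h3⟩ ((w | w) | w) hw
      · exact h2 w fun ⟨a, ha⟩ => hw ⟨.inl a, by rw [← ha]; rfl⟩
      · exact h3 w fun ⟨a, ha⟩ => hw ⟨.inr a, by rw [← ha]; rfl⟩
      · exact congrFun h1 w
  simp only [addAncillasVec, h]
  rw [ite_mul, zero_mul, ite_and, ite_and]
  simp only [mul_ite, mul_zero]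
  rfl

lemma sliceVec_mem {v : (Γ.Reg → Fin 2) → ℂ} (hv : v ∈ Γ.prodVec) (u : Γ.Reg → Fin 2) :
    sliceVec Γ.regOut u v ∈ productVectors (Fin mA) (Fin mB) := by
  obtain ⟨α, β, c, rfl⟩ := hv
  -- The conditions on `u` and `c` are scalars; they are placed in Alice's factor.
  refine ⟨fun a => if (fun i => u (Γ.regOut i)) = 0 ∧ (fun i => u (.inr i)) = c then
    α (Function.extend Γ.outA a fun i => u (.inl (.inl i))) else 0,
    fun b => β (Function.extend Γ.outB b fun i => u (.inl (.inr i))), ?_⟩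
  funext x
  have h1 : (fun i => Function.extend Γ.regOut x u (.inr i)) = fun i => u (.inr i) := by
    funext i
    rw [Function.extend_apply']
    rintro ⟨a | b, hab⟩ <;> cases hab
  have h2 : (fun i => Function.extend Γ.regOut x u (.inl (.inl i))) =
      Function.extend Γ.outA (fun i => x (.inl i)) fun i => u (.inl (.inl i)) := by
    funext i
    by_cases hi : ∃ a, Γ.outA a = i
    · obtain ⟨a, rfl⟩ := hi
      rw [Γ.outA.injective.extend_apply]
      exact Γ.regOut.injective.extend_apply _ _ (.inl a)
    · rw [Function.extend_apply' _ _ _ hi, Function.extend_apply']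
      rintro ⟨a | b, hab⟩
      · cases hab; exact hi ⟨a, rfl⟩
      · cases hab
  have h3 : (fun i => Function.extend Γ.regOut x u (.inl (.inr i))) =
      Function.extend Γ.outB (fun i => x (.inr i)) fun i => u (.inl (.inr i)) := by
    funext i
    by_cases hi : ∃ a, Γ.outB a = i
    · obtain ⟨a, rfl⟩ := hi
      rw [Γ.outB.injective.extend_apply]
      exact Γ.regOut.injective.extend_apply _ _ (.inr a)
    · rw [Function.extend_apply' _ _ _ hi, Function.extend_apply']
      rintro ⟨a | b, hab⟩
      · cases hab
      · cases hab; exact hi ⟨b, rfl⟩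
  simp only [sliceVec, h1, h2, h3, ite_and, ite_mul, zero_mul]

lemma isFreeMap_map : IsFreeMap (productVectors (Fin nA) (Fin nB))
    (productVectors (Fin mA) (Fin mB)) Γ.map :=
  (isFreeMap_reduceTo Γ.regOut fun _ hv u => Γ.sliceVec_mem hv u).comp
    ((Γ.isFreeMap_foldl Γ.rounds).comp
      (isFreeMap_addAncillas Γ.regIn fun _ hv => Γ.addAncillasVec_mem hv))

end LOCC

end Product


/-! ### Pinching -/

section Pinching

open Matrix

variable {V W : Type}

lemma restrictTo_inl_mem [Fintype V] [DecidableEq V] (c : V → Fin 2) (v : (V ⊕ W → Fin 2) → ℂ) :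
    restrictTo Function.Embedding.inl c v ∈ productVectors V W := by
  refine ⟨fun a => if a = c then 1 else 0, fun b => v (Sum.elim c b), ?_⟩
  funext x
  simp only [restrictTo, Function.Embedding.inl_apply, ite_mul, one_mul, zero_mul]
  refine if_ctx_congr Iff.rfl (fun h => ?_) fun _ => rfl
  congr 1
  funext i
  rcases i with i | i
  · exact congrFun h i
  · rfl

/-- Projecting Alice's whole register on a basis state leaves a product vector, so dephasing her
side makes any state separable. -/
lemma isFreeMap_pinching [Fintype V] [DecidableEq V] [Fintype W] [DecidableEq W] :
    IsFreeMap Set.univ (productVectors V W) (measureReg (Function.Embedding.inl : V ↪ V ⊕ W)) :=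
  isFreeMap_measureReg _ fun v _ c => restrictTo_inl_mem c v

/-- Lagrange's identity. Applied to the slices `v_c` of `v = ∑ v_c`, it writes the gap in the
pinching inequality as half the sum of the projectors `|v_c - v_c'⟩⟨v_c - v_c'|`. -/
lemma sum_sum_sub_mul_sub {ι : Type*} [Fintype ι] (a b : ι → ℂ) :
    ∑ i, ∑ j, (a i - a j) * (b i - b j) =
      2 * (Fintype.card ι * ∑ i, a i * b i - (∑ i, a i) * ∑ i, b i) := by
  simp only [sub_mul, mul_sub, Finset.sum_sub_distrib, Finset.sum_const, Finset.card_univ,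
    ← Finset.mul_sum, ← Finset.sum_mul, nsmul_eq_mul]
  ring

/-- The pinching inequality `X ≤ 2^|V| ∑_c P_c X P_c`. -/
lemma posSemidef_smul_measureReg_sub [Fintype V] [DecidableEq V] [Fintype W] [DecidableEq W]
    (e : V ↪ W) {X : QMat W} (hX : X.PosSemidef) :
    ((2 ^ Fintype.card V : ℝ) • measureReg e X - X).PosSemidef := by
  have hlin := isLinearMap_measureReg e
  rw [← mem_pureCone_univ_iff] at hX
  induction hX using AddSubmonoid.closure_induction with
  | mem x hx =>
    obtain ⟨v, -, rfl⟩ := hx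
    have h : (2 ^ Fintype.card V : ℝ) • measureReg e (vecMulVec v (star v)) - vecMulVec v (star v) =
        (1 / 2 : ℝ) • ∑ c, ∑ c', vecMulVec (restrictTo e c v - restrictTo e c' v)
          (star (restrictTo e c v - restrictTo e c' v)) := by
      have hv (x : W → Fin 2) : v x = ∑ c, restrictTo e c v x := by simp [restrictTo]
      ext x y
      rw [measureReg_vecMulVec]
      simp only [Matrix.sub_apply, Matrix.smul_apply, Matrix.sum_apply, vecMulVec_apply,
        Pi.sub_apply, Pi.star_apply, star_sub, sum_sum_sub_mul_sub, Complex.real_smul]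
      rw [hv x, hv y, star_sum]
      simp
    rw [h]
    exact (posSemidef_sum _ fun c _ => posSemidef_sum _ fun c' _ =>
      posSemidef_vecMulVec_self_star _).smul (by norm_num)
  | zero => simp [hlin.map_zero, PosSemidef.zero]
  | add x y _ _ hx hy =>
    rw [hlin.map_add, smul_add, add_sub_add_comm]
    exact hx.add hy

end Pinching

/-! ### Bell pairs and product vectors -/

section Bell

open Matrix

lemma sum_bellVec_mul (m : ℕ) (f : (Fin m ⊕ Fin m → Fin 2) → ℂ) :
    ∑ x, bellVec m x * f x =
      ((1 / Real.sqrt (2 ^ m) : ℝ) : ℂ) * ∑ a : Fin m → Fin 2, f (Sum.elim a a) := by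
  rw [← (Equiv.sumArrowEquivProdArrow (Fin m) (Fin m) (Fin 2)).symm.sum_comp,
    Fintype.sum_prod_type, Finset.mul_sum]
  refine Finset.sum_congr rfl fun a _ => ?_
  rw [Finset.sum_eq_single a]
  · simp [bellVec, Equiv.sumArrowEquivProdArrow]
  · intro b _ hb
    have : ¬ ∀ i, a i = b i := fun h => hb (funext h).symm
    simp [bellVec, Equiv.sumArrowEquivProdArrow, this]
  · simp

lemma star_bellVec (m : ℕ) : star (bellVec m) = bellVec m := by
  funext x
  simp only [bellVec, Pi.star_apply]
  split_ifs
  · exact Complex.conj_ofReal _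
  · exact star_zero _

lemma inv_sqrt_two_pow_sq (m : ℕ) : (1 / Real.sqrt (2 ^ m)) ^ 2 = 1 / 2 ^ m := by
  rw [div_pow, Real.sq_sqrt (by positivity), one_pow]

lemma star_bellVec_dotProduct (m : ℕ) : star (bellVec m) ⬝ᵥ bellVec m = 1 := by
  rw [star_bellVec, dotProduct, sum_bellVec_mul]
  have h (a : Fin m → Fin 2) : bellVec m (Sum.elim a a) = ((1 / Real.sqrt (2 ^ m) : ℝ) : ℂ) := by
    simp [bellVec]
  simp only [h, Finset.sum_const, Finset.card_univ, Fintype.card_fun, Fintype.card_fin,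
    nsmul_eq_mul]
  rw [mul_left_comm, ← sq, ← Complex.ofReal_pow, inv_sqrt_two_pow_sq]
  push_cast
  field_simp

lemma bell_isState (m : ℕ) : IsState (bell m) :=
  ⟨posSemidef_vecMulVec_self_star _, by
    rw [bell, trace_vecMulVec, dotProduct_comm, star_bellVec_dotProduct]⟩

lemma re_trace_vecMulVec_self {n : Type*} [Fintype n] (v : n → ℂ) :
    (vecMulVec v (star v)).trace.re = ∑ i, ‖v i‖ ^ 2 := by
  rw [trace_vecMulVec, dotProduct, Complex.re_sum]
  refine Finset.sum_congr rfl fun i _ => ?_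
  rw [Pi.star_apply, Complex.star_def, Complex.mul_conj', ← Complex.ofReal_pow, Complex.ofReal_re]

lemma trace_vecMulVec_mul_vecMulVec {n : Type*} [Fintype n] (u v : n → ℂ) :
    (vecMulVec u (star u) * vecMulVec v (star v)).trace.re = ‖star u ⬝ᵥ v‖ ^ 2 := by
  have h : star v ⬝ᵥ u = star (star u ⬝ᵥ v) := by simp [dotProduct, star_sum, mul_comm]
  rw [vecMulVec_mul_vecMulVec, trace_vecMulVec, dotProduct_smul, smul_eq_mul, dotProduct_comm u, h,
    Complex.star_def, Complex.mul_conj', ← Complex.ofReal_pow, Complex.ofReal_re]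

lemma re_trace_product_vecMulVec {V W : Type} [Fintype V] [DecidableEq V] [Fintype W]
    [DecidableEq W] (α : (V → Fin 2) → ℂ) (β : (W → Fin 2) → ℂ) {v : (V ⊕ W → Fin 2) → ℂ}
    (hv : v = fun x => α (fun i => x (.inl i)) * β (fun i => x (.inr i))) :
    (vecMulVec v (star v)).trace.re = (∑ a, ‖α a‖ ^ 2) * ∑ b, ‖β b‖ ^ 2 := by
  rw [re_trace_vecMulVec_self, ← (Equiv.sumArrowEquivProdArrow V W (Fin 2)).symm.sum_comp,
    Fintype.sum_prod_type, Finset.sum_mul_sum]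
  simp [hv, Equiv.sumArrowEquivProdArrow, mul_pow]

/-- Separable operators have overlap at most `2^{-m}` with `m` Bell pairs. -/
lemma re_trace_bell_mul_le {m : ℕ} {X : QMat (Fin m ⊕ Fin m)}
    (hX : X ∈ pureCone (productVectors (Fin m) (Fin m))) :
    (bell m * X).trace.re ≤ 1 / 2 ^ m * X.trace.re := by
  induction hX using AddSubmonoid.closure_induction with
  | mem x hx =>
    obtain ⟨v, ⟨α, β, hv⟩, rfl⟩ := hx
    rw [re_trace_product_vecMulVec α β hv, bell, trace_vecMulVec_mul_vecMulVec, star_bellVec,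
      dotProduct, sum_bellVec_mul, norm_mul, mul_pow, Complex.norm_real, Real.norm_eq_abs, sq_abs,
      inv_sqrt_two_pow_sq, hv]
    gcongr
    simp only [Sum.elim_inl, Sum.elim_inr]
    -- The overlap with `α ⊗ β` is `2^{-m/2} ∑ₐ α a β a`, bounded by Cauchy–Schwarz.
    refine le_trans ?_ (Finset.sum_mul_sq_le_sq_mul_sq _ _ _)
    gcongr
    refine (norm_sum_le _ _).trans (le_of_eq ?_)
    simp
  | zero => simp
  | add x y _ _ hx hy =>
    rw [Matrix.mul_add, trace_add, trace_add, Complex.add_re, Complex.add_re, mul_add]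
    exact add_le_add hx hy

end Bell

/-! ### Separable states -/

section Separable

open Matrix

variable {V W : Type}

lemma tensor_mem_pureCone [Fintype V] [Fintype W] {A : QMat V} {B : QMat W} (hA : A.PosSemidef) (hB : B.PosSemidef) :
    tensor A B ∈ pureCone (productVectors V W) := by
  obtain ⟨k, v, rfl⟩ := posSemidef_iff_eq_sum_vecMulVec.1 hA
  obtain ⟨l, w, rfl⟩ := posSemidef_iff_eq_sum_vecMulVec.1 hB
  have h : tensor (∑ i, vecMulVec (v i) (star (v i))) (∑ j, vecMulVec (w j) (star (w j))) =
      ∑ i, ∑ j, vecMulVec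
        (fun x : V ⊕ W → Fin 2 => v i (fun a => x (.inl a)) * w j (fun b => x (.inr b)))
        (star fun x : V ⊕ W → Fin 2 => v i (fun a => x (.inl a)) * w j (fun b => x (.inr b))) := by
    ext x y
    simp only [tensor, Matrix.sum_apply, vecMulVec_apply, Pi.star_apply, Finset.sum_mul_sum,
      star_mul']
    refine Finset.sum_congr rfl fun i _ => Finset.sum_congr rfl fun j _ => ?_
    ring
  rw [h]
  exact sum_mem fun i _ => sum_mem fun j _ => vecMulVec_mem_pureCone ⟨v i, w j, rfl⟩

/-- The cone is defined only as an additive monoid; the scalar `r` is moved into the generators as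
`√r`. -/
lemma smul_mem_pureCone {n : Type*} {S : Set (n → ℂ)} (hS : ∀ v ∈ S, ∀ c : ℝ, c • v ∈ S) {r : ℝ}
    (hr : 0 ≤ r) {X : Matrix n n ℂ} (hX : X ∈ pureCone S) : r • X ∈ pureCone S := by
  induction hX using AddSubmonoid.closure_induction with
  | mem x hx =>
    obtain ⟨v, hv, rfl⟩ := hx
    have h : r • vecMulVec v (star v) = vecMulVec (√r • v) (star (√r • v)) := by
      ext i j
      have h2 : (r : ℂ) = √r * √r := by rw [← Complex.ofReal_mul, Real.mul_self_sqrt hr]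
      simp only [Matrix.smul_apply, vecMulVec_apply, Pi.star_apply, Pi.smul_apply,
        Complex.real_smul, star_mul', Complex.star_def, Complex.conj_ofReal]
      rw [h2]
      ring
    change r • vecMulVec v (star v) ∈ _
    rw [h]
    exact vecMulVec_mem_pureCone (hS v hv _)
  | zero => rw [smul_zero]; exact zero_mem _
  | add x y _ _ hx hy => rw [smul_add]; exact add_mem hx hy

lemma smul_mem_pureCone_productVectors {r : ℝ} (hr : 0 ≤ r) {X : QMat (V ⊕ W)}
    (hX : X ∈ pureCone (productVectors V W)) : r • X ∈ pureCone (productVectors V W) := by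
  refine smul_mem_pureCone ?_ hr hX
  rintro _ ⟨α, β, rfl⟩ c
  refine ⟨c • α, β, ?_⟩
  funext x
  simp [mul_assoc]

variable [Fintype V] [DecidableEq V] [Fintype W] [DecidableEq W]

lemma trace_tensor (A : QMat V) (B : QMat W) : (tensor A B).trace = A.trace * B.trace := by
  rw [trace, ← (Equiv.sumArrowEquivProdArrow V W (Fin 2)).symm.sum_comp, Fintype.sum_prod_type,
    trace, trace, Finset.sum_mul_sum]
  rfl

lemma mem_pureCone_and_trace_of_mem_SEP {σ : QMat (V ⊕ W)} (hσ : σ ∈ SEP V W) :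
    σ ∈ pureCone (productVectors V W) ∧ σ.trace = 1 := by
  refine convexHull_min (t := {σ | σ ∈ pureCone (productVectors V W) ∧ σ.trace = 1}) ?_ ?_ hσ
  · rintro _ ⟨σA, σB, hA, hB, rfl⟩
    exact ⟨tensor_mem_pureCone hA.1 hB.1, by rw [trace_tensor, hA.2, hB.2, mul_one]⟩
  · intro x hx y hy a b ha hb hab
    refine ⟨add_mem (smul_mem_pureCone_productVectors ha hx.1)
      (smul_mem_pureCone_productVectors hb hy.1), ?_⟩
    rw [trace_add, trace_smul, trace_smul, hx.2, hy.2, ← add_smul, hab, one_smul]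

lemma exists_isState (V : Type) [Fintype V] [DecidableEq V] : ∃ σ : QMat V, IsState σ := by
  refine ⟨vecMulVec (Pi.single 0 1) (star (Pi.single 0 1)), posSemidef_vecMulVec_self_star _, ?_⟩
  simp [trace_vecMulVec]

lemma exists_eq_smul_isState {A : QMat V} (hA : A.PosSemidef) :
    ∃ (t : ℝ) (σ : QMat V), 0 ≤ t ∧ IsState σ ∧ A = t • σ := by
  have htr : A.trace = (A.trace.re : ℂ) :=
    Complex.eq_re_of_ofReal_le (r := 0) (by simpa using hA.trace_nonneg)
  have h0 : 0 ≤ A.trace.re := (Complex.le_def.1 hA.trace_nonneg).1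
  by_cases h : A.trace.re = 0
  · obtain ⟨σ, hσ⟩ := exists_isState V
    refine ⟨0, σ, le_rfl, hσ, ?_⟩
    rw [zero_smul, ← hA.trace_eq_zero_iff, htr, h, Complex.ofReal_zero]
  · refine ⟨A.trace.re, A.trace.re⁻¹ • A, h0, ⟨hA.smul (inv_nonneg.2 h0), ?_⟩, ?_⟩
    · rw [trace_smul, htr, Complex.real_smul, ← Complex.ofReal_mul, Complex.ofReal_re,
        inv_mul_cancel₀ h, Complex.ofReal_one]
    · rw [smul_inv_smul₀ h]

open scoped Pointwise in
lemma exists_eq_smul_mem_SEP {X : QMat (V ⊕ W)} (hX : X ∈ pureCone (productVectors V W)) :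
    ∃ (t : ℝ) (σ : QMat (V ⊕ W)), 0 ≤ t ∧ σ ∈ SEP V W ∧ X = t • σ := by
  have hprod {σA : QMat V} {σB : QMat W} (hA : IsState σA) (hB : IsState σB) :
      tensor σA σB ∈ SEP V W := subset_convexHull _ _ ⟨σA, σB, hA, hB, rfl⟩
  induction hX using AddSubmonoid.closure_induction with
  | mem x hx =>
    obtain ⟨v, ⟨α, β, hv⟩, rfl⟩ := hx
    obtain ⟨t, σA, ht, hA, hαA⟩ := exists_eq_smul_isState (posSemidef_vecMulVec_self_star α)
    obtain ⟨u, σB, hu, hB, hβB⟩ := exists_eq_smul_isState (posSemidef_vecMulVec_self_star β)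
    refine ⟨t * u, tensor σA σB, mul_nonneg ht hu, hprod hA hB, ?_⟩
    ext x y
    have h1 := congrFun₂ hαA (fun i => x (.inl i)) (fun i => y (.inl i))
    have h2 := congrFun₂ hβB (fun i => x (.inr i)) (fun i => y (.inr i))
    simp only [Matrix.smul_apply, vecMulVec_apply, Pi.star_apply, Complex.real_smul] at h1 h2
    simp only [hv, vecMulVec_apply, Pi.star_apply, star_mul', Matrix.smul_apply, tensor,
      Complex.real_smul, Complex.ofReal_mul]
    linear_combination (β fun i => x (.inr i)) * star (β fun i => y (.inr i)) * h1
      + t * σA (fun i => x (.inl i)) (fun i => y (.inl i)) * h2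
  | zero =>
    obtain ⟨σA, hA⟩ := exists_isState V
    obtain ⟨σB, hB⟩ := exists_isState W
    exact ⟨0, tensor σA σB, le_rfl, hprod hA hB, (zero_smul _ _).symm⟩
  | add x y _ _ hx hy =>
    obtain ⟨t, σ, ht, hσ, rfl⟩ := hx
    obtain ⟨u, τ, hu, hτ, rfl⟩ := hy
    have h : t • σ + u • τ ∈ (t + u) • SEP V W := by
      have hc : Convex ℝ (SEP V W) := convex_convexHull ℝ _
      -- By convexity, `(t + u) SEP = t SEP + u SEP`.
      rw [hc.add_smul ht hu]
      exact Set.add_mem_add (Set.smul_mem_smul_set hσ) (Set.smul_mem_smul_set hτ)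
    obtain ⟨ω, hω, h⟩ := h
    exact ⟨t + u, ω, add_nonneg ht hu, hω, h.symm⟩

lemma mem_SEP_of_mem_pureCone {X : QMat (V ⊕ W)} (hX : X ∈ pureCone (productVectors V W))
    (htr : X.trace = 1) : X ∈ SEP V W := by
  obtain ⟨t, σ, ht, hσ, rfl⟩ := exists_eq_smul_mem_SEP hX
  have h := (mem_pureCone_and_trace_of_mem_SEP hσ).2
  rw [trace_smul, h, Complex.real_smul, mul_one, Complex.ofReal_eq_one] at htr
  rwa [htr, one_smul]

end Separable


/-! ### Binary measurements -/

section Outcomes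

open Matrix

variable {V : Type} [Fintype V] [DecidableEq V]

lemma outcome_nonneg {E X : QMat V} (hE : E.PosSemidef) (hE' : (1 - E).PosSemidef)
    (hX : X.PosSemidef) (i : Fin 2) : 0 ≤ outcome E X i := by
  fin_cases i
  · exact re_trace_mul_nonneg hE hX
  · exact re_trace_mul_nonneg hE' hX

lemma outcome_add (E X Y : QMat V) (i : Fin 2) :
    outcome E (X + Y) i = outcome E X i + outcome E Y i := by
  fin_cases i <;> simp [outcome, Matrix.mul_add]

lemma outcome_sub (E X Y : QMat V) (i : Fin 2) :
    outcome E (X - Y) i = outcome E X i - outcome E Y i := by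
  fin_cases i <;> simp [outcome, Matrix.mul_sub]

lemma outcome_smul (E X : QMat V) (r : ℝ) (i : Fin 2) :
    outcome E (r • X) i = r * outcome E X i := by
  fin_cases i <;> simp [outcome]

lemma outcome_one (E X : QMat V) : outcome E X 1 = X.trace.re - (E * X).trace.re := by
  simp [outcome, Matrix.sub_mul]

lemma sum_outcome (E X : QMat V) : ∑ i, outcome E X i = X.trace.re := by
  rw [Fin.sum_univ_two, outcome_one]
  simp [outcome]

lemma outcome_mono {E X Y : QMat V} (hE : E.PosSemidef) (hE' : (1 - E).PosSemidef)
    (h : (Y - X).PosSemidef) (i : Fin 2) : outcome E X i ≤ outcome E Y i := by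
  have := outcome_nonneg hE hE' h i
  rw [outcome_sub] at this
  linarith

lemma EffectFamily.isEffect_bipartite {G : GateSet} (𝓔 : EffectFamily G) {a b : ℕ}
    {E : QMat (Fin a ⊕ Fin b)} (hE : E ∈ 𝓔.bipartite a b) :
    E.PosSemidef ∧ (1 - E).PosSemidef := by
  obtain ⟨h1, h2⟩ := 𝓔.isEffect _ _ hE
  let f : (Fin a ⊕ Fin b → Fin 2) → (Fin (a + b) → Fin 2) := fun x i => x (finSumFinEquiv.symm i)
  have hf : Function.Injective f := fun x y h => funext fun i => by
    simpa [f] using congrFun h (finSumFinEquiv i)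
  have e1 : E = (relabel finSumFinEquiv E).submatrix f f := by
    ext x y
    simp [relabel, f]
  have e2 : 1 - E = (1 - relabel finSumFinEquiv E).submatrix f f := by
    rw [submatrix_sub, Pi.sub_apply, Pi.sub_apply, ← e1, submatrix_one f hf]
  rw [e2]
  nth_rewrite 1 [e1]
  exact ⟨h1.submatrix f, h2.submatrix f⟩

/-- An empty set cannot span the nonzero space of operators. Nonemptiness keeps the supremum over
effects from being `-∞`. -/
lemma EffectFamily.bipartite_nonempty {G : GateSet} (𝓔 : EffectFamily G) (a b : ℕ) :
    (𝓔.bipartite a b).Nonempty := by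
  have h : (𝓔.eff (a + b)).Nonempty := by
    by_contra h
    have hs := 𝓔.span_eq_top (a + b)
    rw [Set.not_nonempty_iff_eq_empty.1 h, Submodule.span_empty] at hs
    exact bot_ne_top hs
  obtain ⟨E, hE⟩ := h
  refine ⟨relabel finSumFinEquiv.symm E, ?_⟩
  have : relabel finSumFinEquiv (relabel finSumFinEquiv.symm E) = E := by
    ext x y
    simp [relabel]
  rwa [EffectFamily.bipartite, Set.mem_ofPred_eq, this]

lemma measuredRelEntropy_nonneg {𝓜 : Set (QMat V)} (hne : 𝓜.Nonempty)
    (h𝓜 : ∀ E ∈ 𝓜, E.PosSemidef ∧ (1 - E).PosSemidef) {ρ σ : QMat V} (hρ : IsState ρ)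
    (hσ : IsState σ) : 0 ≤ measuredRelEntropy 𝓜 ρ σ := by
  obtain ⟨E, hE⟩ := hne
  refine le_trans ?_ (le_iSup₂ (f := fun E (_ : E ∈ 𝓜) => relEntropy (outcome E ρ) (outcome E σ))
    E hE)
  by_contra hlt
  obtain ⟨r, hr, hr0⟩ := EReal.lt_iff_exists_real_btwn.1 (not_le.1 hlt)
  have h := sum_le_of_relEntropy_le (x := fun _ => 1)
    (outcome_nonneg (h𝓜 E hE).1 (h𝓜 E hE).2 hρ.1) (outcome_nonneg (h𝓜 E hE).1 (h𝓜 E hE).2 hσ.1)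
    (fun _ => one_pos) hr.le
  simp only [Real.log_one, mul_zero, zero_add, mul_one, Finset.sum_sub_distrib, sum_outcome,
    hρ.2, hσ.2, sub_self] at h
  have hr0' : r < 0 := by exact_mod_cast hr0
  nlinarith [Real.log_pos one_lt_two]

/-- If every binary measurement in `𝓜` has relative entropy at most `r`, then so has every
convex combination of them, up to the binary entropy. -/
lemma mul_sub_binEntropy_le {𝓜 : Set (QMat V)}
    (h𝓜 : ∀ E ∈ 𝓜, E.PosSemidef ∧ (1 - E).PosSemidef) {ρ σ : QMat V} (hρ : IsState ρ)
    (hσ : IsState σ) {r : ℝ} (hr : ∀ E ∈ 𝓜, relEntropy (outcome E ρ) (outcome E σ) ≤ (r : EReal))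
    {F : QMat V} (hF : F ∈ convexHull ℝ 𝓜) {p q : ℝ} (hp : (F * ρ).trace.re = p)
    (hq : (F * σ).trace.re = q) (hp0 : 0 ≤ p) (hp1 : p ≤ 1) (hq0 : 0 ≤ q) {m : ℕ}
    (hqm : q ≤ 1 / 2 ^ m) : p * m - Real.binEntropy p / Real.log 2 ≤ r := by
  have hl : 0 < Real.log 2 := Real.log_pos one_lt_two
  suffices h : p * m * Real.log 2 - Real.binEntropy p ≤ r * Real.log 2 by
    rw [← sub_nonneg] at h ⊢
    have : r - (p * m - Real.binEntropy p / Real.log 2) =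
      (r * Real.log 2 - (p * m * Real.log 2 - Real.binEntropy p)) / Real.log 2 := by field_simp
    rw [this]
    positivity
  refine le_of_forall_pos_le_add fun δ hδ => ?_
  -- These are the optimal multipliers `p/q` and `(1-p)/(1-q)`, with `q` replaced by `2^{-m}` in the
  -- first and `1 - q` by `1` in the second; `δ` keeps them positive.
  set x : ℝ := (p + δ / 2) * 2 ^ m with hx
  set y : ℝ := 1 - p + δ / 2 with hy
  have hx0 : 0 < x := by positivity
  have hy0 : 0 < y := by linarith
  -- For fixed `x` and `y` the variational inequality is a half-space in the effect, so it extends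
  -- from `𝓜` to its convex hull.
  have hconv : Convex ℝ {F : QMat V | (F * ρ).trace.re * (Real.log x - Real.log y)
      + (F * σ).trace.re * (y - x) ≤ r * Real.log 2 - Real.log y - 1 + y} := by
    refine convex_halfSpace_le ⟨fun A B => ?_, fun c A => ?_⟩ _
    · simp only [Matrix.add_mul, trace_add, Complex.add_re]
      ring
    · simp only [Matrix.smul_mul, trace_smul, Complex.smul_re, smul_eq_mul]
      ring
  have hmem := convexHull_min (fun E hE => ?_) hconv hF
  · rw [Set.mem_ofPred_eq, hp, hq] at hmem
    have h2m : (0 : ℝ) < 2 ^ m := by positivity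
    have hlogx : Real.log x = Real.log (p + δ / 2) + m * Real.log 2 := by
      rw [hx, Real.log_mul (by positivity) h2m.ne', Real.log_pow]
    have h1 : p * Real.log p ≤ p * Real.log (p + δ / 2) := by
      rcases hp0.eq_or_lt with h | h
      · simp [← h]
      · gcongr
        linarith
    have h2 : (1 - p) * Real.log (1 - p) ≤ (1 - p) * Real.log y := by
      rcases (sub_nonneg.2 hp1).eq_or_lt with h | h
      · simp [← h]
      · gcongr
        linarith
    have h3 : q * x ≤ p + δ / 2 := by
      calc q * x ≤ 1 / 2 ^ m * x := by gcongr
        _ = p + δ / 2 := by rw [hx]; field_simp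
    have h4 : 0 ≤ q * y := by positivity
    rw [hlogx] at hmem
    rw [Real.binEntropy, Real.log_inv, Real.log_inv]
    nlinarith
  · have h := sum_le_of_relEntropy_le (x := ![x, y])
      (outcome_nonneg (h𝓜 E hE).1 (h𝓜 E hE).2 hρ.1) (outcome_nonneg (h𝓜 E hE).1 (h𝓜 E hE).2 hσ.1)
      (fun i => by fin_cases i <;> simp [hx0, hy0]) (hr E hE)
    rw [Fin.sum_univ_two, outcome_one, outcome_one, hρ.2, hσ.2] at h
    simp only [outcome, cons_val_zero, cons_val_one, Complex.one_re] at h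
    rw [Set.mem_ofPred_eq]
    linarith

end Outcomes

/-! ### Distillation -/

section Main

open Matrix

variable {G : GateSet}

lemma compER_nonneg (𝓔 : EffectFamily G) {n : ℕ} {ρ : QMat (Fin n ⊕ Fin n)} (hρ : IsState ρ) :
    0 ≤ compER 𝓔 ρ :=
  le_iInf₂ fun _ hσ => measuredRelEntropy_nonneg (𝓔.bipartite_nonempty n n)
    (fun _ hE => 𝓔.isEffect_bipartite hE) hρ
    ⟨posSemidef_of_mem_pureCone (mem_pureCone_and_trace_of_mem_SEP hσ).1,
      (mem_pureCone_and_trace_of_mem_SEP hσ).2⟩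

lemma one_sub_bell_posSemidef (m : ℕ) : (1 - bell m).PosSemidef := by
  have h1 : (bell m)ᴴ = bell m := (bell_isState m).1.isHermitian
  have h2 : bell m * bell m = bell m := by
    rw [bell, vecMulVec_mul_vecMulVec, star_bellVec_dotProduct, one_smul]
  obtain ⟨h3, h4⟩ := one_sub_idempotent h1 h2
  exact posSemidef_of_idempotent h3 h4

lemma re_trace_bell_mul_le_one {m : ℕ} {ρ : QMat (Fin m ⊕ Fin m)} (hρ : IsState ρ) :
    (bell m * ρ).trace.re ≤ 1 := by
  have h := re_trace_mul_nonneg (one_sub_bell_posSemidef m) hρ.1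
  rw [Matrix.sub_mul, trace_sub, Matrix.one_mul, hρ.2, Complex.sub_re, Complex.one_re] at h
  linarith

/-- An LOCC map from `n + n` qubits produces `m` Bell pairs with fidelity at most `2^{n-m}`. -/
lemma re_trace_bell_mul_map_le {n m : ℕ} (Γ : LOCC G n n m m) {ρ : QMat (Fin n ⊕ Fin n)}
    (hρ : IsState ρ) : (bell m * Γ.map ρ).trace.re ≤ 2 ^ n / 2 ^ m := by
  have hΓ := Γ.isFreeMap_map
  have hpin := isFreeMap_pinching (V := Fin n) (W := Fin n)
  -- `Γ` preserves `ρ ≤ 2^n ρ'`, where `ρ'` is the dephased, hence separable, state; the image of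
  -- `ρ'` overlaps the Bell pairs by at most `2^{-m}`.
  have h1 := hΓ.map_posSemidef (posSemidef_smul_measureReg_sub Function.Embedding.inl hρ.1)
  have hlin : ∀ (r : ℝ) X, Γ.map (r • X) = r • Γ.map X := fun r X => by
    rw [← Complex.coe_smul, hΓ.isLinear.map_smul, Complex.coe_smul]
  rw [hΓ.isLinear.map_sub, hlin, Fintype.card_fin] at h1
  have h2 := re_trace_mul_nonneg (bell_isState m).1 h1
  have h3 := re_trace_bell_mul_le (hΓ.map_mem (hpin.map_mem (mem_pureCone_univ_iff.2 hρ.1)))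
  rw [hΓ.trace_map, hpin.trace_map, hρ.2, Complex.one_re, mul_one] at h3
  rw [Matrix.mul_sub, trace_sub, Matrix.mul_smul, trace_smul, Complex.sub_re, Complex.smul_re,
    smul_eq_mul] at h2
  have h4 : (2 : ℝ) ^ n * (bell m * Γ.map (measureReg Function.Embedding.inl ρ)).trace.re ≤
      2 ^ n * (1 / 2 ^ m) := by gcongr
  rw [mul_one_div] at h4
  linarith

/-- The pulled-back Bell test separates `ρ` from all separable states at once. The first alternative
in `hmκ` needs no restriction on `ε`; the second admits `κ = n` although `m` may exceed `n` by one.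
-/
lemma le_compER_add_contTerm (𝓔in 𝓔out : EffectFamily G) {n m : ℕ} (hm : 1 ≤ m)
    (hBell : bell m ∈ 𝓔out.bipartite m m) {ρ : QMat (Fin n ⊕ Fin n)} (hρ : IsState ρ)
    (Γ : LOCC G n n m m)
    (hΓ : TestStable (𝓔in.bipartite n n) (𝓔out.bipartite m m) Γ.map) {ε : ℝ}
    (hε0 : 0 ≤ ε) (hε1 : ε ≤ 1) (hF : 1 - fidelity (Γ.map ρ) (bell m) ≤ ε) {κ : ℝ} (hκ : 0 ≤ κ)
    (hmκ : (m : ℝ) ≤ κ ∨ ε ≤ 1 / 2 ∧ (m : ℝ) ≤ κ + 1) :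
    (m : EReal) ≤ compER 𝓔in ρ + (contTerm (√ε) κ : EReal) := by
  have hfree := Γ.isFreeMap_map
  have hΓρ := hfree.map_isState hρ
  obtain ⟨F, hFc, hFX⟩ := hΓ _ hBell
  set p : ℝ := (bell m * Γ.map ρ).trace.re with hp
  have hpF : 1 - ε ≤ p := by
    have : fidelity (Γ.map ρ) (bell m) ≤ p :=
      fidelity_vecMulVec_le hΓρ.1 (star_bellVec_dotProduct m)
    linarith
  have hp0 : 0 ≤ p := re_trace_mul_nonneg (bell_isState m).1 hΓρ.1
  have hp1 : p ≤ 1 := re_trace_bell_mul_le_one hΓρ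
  have hlow : ((p * m - Real.binEntropy p / Real.log 2 : ℝ) : EReal) ≤ compER 𝓔in ρ := by
    refine le_iInf₂ fun σ hσ => ?_
    obtain ⟨hσc, hσt⟩ := mem_pureCone_and_trace_of_mem_SEP hσ
    have hσs : IsState σ := ⟨posSemidef_of_mem_pureCone hσc, hσt⟩
    -- The supremum may be infinite; a real `r` strictly above it is extracted before the
    -- real-valued estimate is applied.
    by_contra hlt
    obtain ⟨r, hr, hr'⟩ := EReal.lt_iff_exists_real_btwn.1 (not_le.1 hlt)
    have hq := re_trace_bell_mul_le (hfree.map_mem hσc)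
    rw [hfree.trace_map, hσt, Complex.one_re, mul_one, ← hFX] at hq
    have hq0 : 0 ≤ (F * σ).trace.re := by
      rw [hFX]
      exact re_trace_mul_nonneg (bell_isState m).1 (hfree.map_posSemidef hσs.1)
    have h := mul_sub_binEntropy_le (fun _ hE => 𝓔in.isEffect_bipartite hE) hρ hσs
      (fun E hE => (le_iSup₂ (f := fun E (_ : E ∈ 𝓔in.bipartite n n) =>
        relEntropy (outcome E ρ) (outcome E σ)) E hE).trans hr.le)
      hFc (by rw [hFX]) rfl hp0 hp1 hq0 hq
    exact absurd hr' (not_lt.2 (by exact_mod_cast h))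
  have hs2 : √ε ^ 2 = ε := Real.sq_sqrt hε0
  have hreal := le_sub_binEntropy_add_contTerm (s := √ε) (t := 1 - p) (κ := κ) (m := m)
    (Real.sqrt_nonneg _) (Real.sqrt_le_one.2 hε1) (by linarith) (by rw [hs2]; linarith)
    (by positivity) hκ (by rwa [hs2])
  rw [Real.binEntropy_one_sub, sub_sub_cancel] at hreal
  calc (m : EReal) = ((m : ℝ) : EReal) := by simp
    _ ≤ ((p * m - Real.binEntropy p / Real.log 2 + contTerm (√ε) κ : ℝ) : EReal) := by
      exact_mod_cast hreal
    _ = ((p * m - Real.binEntropy p / Real.log 2 : ℝ) : EReal) + (contTerm (√ε) κ : EReal) :=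
      EReal.coe_add _ _
    _ ≤ _ := by gcongr

/-- This covers `m = 0`, where no Bell test is assumed to be available. -/
lemma zero_le_compER_add_contTerm (𝓔 : EffectFamily G) {n : ℕ} {ρ : QMat (Fin n ⊕ Fin n)}
    (hρ : IsState ρ) {ε κ : ℝ} (hε1 : ε ≤ 1) (hκ : 0 ≤ κ) :
    (0 : EReal) ≤ compER 𝓔 ρ + (contTerm (√ε) κ : EReal) :=
  add_nonneg (compER_nonneg 𝓔 hρ)
    (by exact_mod_cast contTerm_nonneg (Real.sqrt_nonneg _) (Real.sqrt_le_one.2 hε1) hκ)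

/-! ### Entanglement cost -/

/-- The error part `N` of `ρ` need not be dominated by the image of the dephased Bell pairs, so the
candidate state also receives the dephased `N`. This costs `log (1 + s)` for normalization and `s n`
for the domination `N ≤ 2^n M`. -/
lemma compER_le_add_contTerm (𝓔 : EffectFamily G) {n k : ℕ} {ρ : QMat (Fin n ⊕ Fin n)}
    (hρ : IsState ρ) (Γ : LOCC G k k n n) {ε : ℝ} (hε1 : ε ≤ 1)
    (hF : 1 - fidelity ρ (Γ.map (bell k)) ≤ ε) :
    compER 𝓔 ρ ≤ (k : EReal) + (contTerm (√ε) n : EReal) := by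
  have hΓ := Γ.isFreeMap_map
  have hbell := bell_isState k
  have hΓb := hΓ.map_isState hbell
  have hpk := isFreeMap_pinching (V := Fin k) (W := Fin k)
  have hpn := isFreeMap_pinching (V := Fin n) (W := Fin n)
  obtain ⟨N, hN, hNt, hNρ⟩ := exists_le_add_of_fidelity hρ hΓb hF
  set s : ℝ := √ε with hs
  have hs0 : 0 ≤ s := Real.sqrt_nonneg _
  have hs1 : s ≤ 1 := Real.sqrt_le_one.2 hε1
  have hs1' : (0 : ℝ) < 1 + s := by linarith
  set σ' := Γ.map (measureReg Function.Embedding.inl (bell k)) with hσ'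
  set M := measureReg (Function.Embedding.inl : Fin n ↪ Fin n ⊕ Fin n) N with hM
  have hσ'c : σ' ∈ pureCone (productVectors (Fin n) (Fin n)) :=
    hΓ.map_mem (hpk.map_mem (mem_pureCone_univ_iff.2 hbell.1))
  have hMc : M ∈ pureCone (productVectors (Fin n) (Fin n)) :=
    hpn.map_mem (mem_pureCone_univ_iff.2 hN)
  have hσ't : σ'.trace = 1 := by rw [hσ', hΓ.trace_map, hpk.trace_map, hbell.2]
  have hMt : M.trace = (s : ℂ) := by rw [hM, hpn.trace_map, hNt]
  have hlin : ∀ (r : ℝ) X, Γ.map (r • X) = r • Γ.map X := fun r X => by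
    rw [← Complex.coe_smul, hΓ.isLinear.map_smul, Complex.coe_smul]
  have hdomk : ((2 ^ k : ℝ) • σ' - Γ.map (bell k)).PosSemidef := by
    have h := hΓ.map_posSemidef (posSemidef_smul_measureReg_sub Function.Embedding.inl hbell.1)
    rwa [hΓ.isLinear.map_sub, hlin, Fintype.card_fin] at h
  have hdomn : ((2 ^ n : ℝ) • M - N).PosSemidef := by
    have h := posSemidef_smul_measureReg_sub (Function.Embedding.inl : Fin n ↪ Fin n ⊕ Fin n) hN
    rwa [Fintype.card_fin] at h
  -- `σ'` has trace `1` and `M` has trace `s`, whence the factor `(1 + s)⁻¹`.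
  set σ := (1 + s)⁻¹ • (σ' + M) with hσ
  have hσS : σ ∈ SEP (Fin n) (Fin n) := by
    refine mem_SEP_of_mem_pureCone
      (smul_mem_pureCone_productVectors (inv_nonneg.2 hs1'.le) (add_mem hσ'c hMc)) ?_
    rw [trace_smul, trace_add, hσ't, hMt, Complex.real_smul, ← Complex.ofReal_one,
      ← Complex.ofReal_add, ← Complex.ofReal_mul, inv_mul_cancel₀ hs1'.ne']
  refine (iInf₂_le σ hσS).trans (iSup₂_le fun E hE => ?_)
  obtain ⟨hE1, hE2⟩ := 𝓔.isEffect_bipartite hE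
  have key := relEntropy_le_of_le_add (p := outcome E ρ) (q := outcome E σ)
    (p' := outcome E (Γ.map (bell k))) (q' := outcome E σ') (d := outcome E N) (e := outcome E M)
    (s := s) (K := 2 ^ k) (L := 2 ^ n)
    (outcome_nonneg hE1 hE2 hρ.1) (outcome_nonneg hE1 hE2 hΓb.1)
    (outcome_nonneg hE1 hE2 (posSemidef_of_mem_pureCone hσ'c)) (outcome_nonneg hE1 hE2 hN)
    (outcome_nonneg hE1 hE2 (posSemidef_of_mem_pureCone hMc)) hs0
    (fun i => by
      rw [hσ, outcome_smul, outcome_add]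
      field_simp)
    (fun i => by
      rw [← outcome_add]
      exact outcome_mono hE1 hE2 hNρ i)
    (fun i => by
      rw [← outcome_smul]
      exact outcome_mono hE1 hE2 hdomk i)
    (fun i => by
      rw [← outcome_smul]
      exact outcome_mono hE1 hE2 hdomn i)
    (by rw [sum_outcome, hρ.2, Complex.one_re]) (by rw [sum_outcome, hΓb.2, Complex.one_re])
    (by rw [sum_outcome, hσ't, Complex.one_re]) (by rw [sum_outcome, hNt, Complex.ofReal_re])
    (by rw [sum_outcome, hMt, Complex.ofReal_re])
  refine key.trans ?_
  rw [Real.log_pow, Real.log_pow]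
  have h := entropy_bound_le_contTerm hs0 hs1 k n
  calc _ ≤ (((k : ℝ) + contTerm s n : ℝ) : EReal) := by exact_mod_cast h
    _ = _ := by rw [EReal.coe_add]; simp

end Main

end

end CompEnt

theorem mainTheorem4 (G : CompEnt.GateSet) (hG : G.IsApproxUniversal)
    (𝓔 𝓔out : CompEnt.EffectFamily G)
    (hBell : ∀ m : ℕ, 1 ≤ m → CompEnt.bell m ∈ 𝓔out.bipartite m m)
    (ε : ℕ → ℝ) (hε : ∀ n, 1 ≤ n → 0 ≤ ε n ∧ ε n ≤ 1)
    (ρ : ∀ n : ℕ, CompEnt.QMat (Fin n ⊕ Fin n)) (hρ : ∀ n, 1 ≤ n → CompEnt.IsState (ρ n)) :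
    (∀ n, 1 ≤ n → ε n ≤ 1 / 2 →
      CompEnt.distillableEntanglement 𝓔 𝓔out ε ρ n ≤
        CompEnt.compER 𝓔 (ρ n) + (CompEnt.contTerm (Real.sqrt (ε n)) n : EReal)) ∧
    (∀ m : ℕ → ℕ, CompEnt.IsDistillable 𝓔 𝓔out ε ρ m → ∀ n, 1 ≤ n →
      ((m n : ℕ) : EReal) ≤
        CompEnt.compER 𝓔 (ρ n) +
          (CompEnt.contTerm (Real.sqrt (ε n)) (max (n : ℝ) (m n : ℝ)) : EReal)) ∧
    (∀ n, 1 ≤ n →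
      CompEnt.compER 𝓔 (ρ n) - (CompEnt.contTerm (Real.sqrt (ε n)) n : EReal) ≤
        CompEnt.entanglementCost G ε ρ n) := by
  refine ⟨fun n hn hεn => iSup₂_le fun m hm => ?_, fun m hm n hn => ?_, fun n hn => ?_⟩
  · obtain ⟨Γ, -, hΓ⟩ := hm
    obtain ⟨hΓs, hΓF⟩ := hΓ n hn
    rcases Nat.eq_zero_or_pos (m n) with h0 | h0
    · rw [h0, Nat.cast_zero]
      exact CompEnt.zero_le_compER_add_contTerm 𝓔 (hρ n hn) (hε n hn).2 (Nat.cast_nonneg n)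
    refine CompEnt.le_compER_add_contTerm 𝓔 𝓔out h0 (hBell _ h0) (hρ n hn) (Γ n) hΓs (hε n hn).1
      (hε n hn).2 hΓF (Nat.cast_nonneg n) (Or.inr ⟨hεn, ?_⟩)
    have h1 := CompEnt.re_trace_bell_mul_map_le (Γ n) (hρ n hn)
    have h2 : CompEnt.fidelity ((Γ n).map (ρ n)) (CompEnt.bell (m n)) ≤
        (CompEnt.bell (m n) * (Γ n).map (ρ n)).trace.re :=
      CompEnt.fidelity_vecMulVec_le ((Γ n).isFreeMap_map.map_isState (hρ n hn)).1
        (CompEnt.star_bellVec_dotProduct (m n))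
    -- The fidelity is at least `1 - ε ≥ 1/2` and at most `2^{n-m}`, so `m ≤ n + 1`.
    have h3 : (1 / 2 : ℝ) ≤ 2 ^ n / 2 ^ m n := by linarith
    rw [div_le_div_iff₀ two_pos (by positivity), one_mul, ← pow_succ] at h3
    exact_mod_cast (pow_le_pow_iff_right₀ (one_lt_two : (1 : ℝ) < 2)).1 h3
  · obtain ⟨Γ, -, hΓ⟩ := hm
    obtain ⟨hΓs, hΓF⟩ := hΓ n hn
    have hκ : (0 : ℝ) ≤ max (n : ℝ) (m n : ℝ) := le_max_of_le_left (Nat.cast_nonneg n)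
    rcases Nat.eq_zero_or_pos (m n) with h0 | h0
    · have := CompEnt.zero_le_compER_add_contTerm 𝓔 (hρ n hn) (hε n hn).2 hκ
      simpa only [h0, Nat.cast_zero] using this
    exact CompEnt.le_compER_add_contTerm 𝓔 𝓔out h0 (hBell _ h0) (hρ n hn) (Γ n) hΓs (hε n hn).1
      (hε n hn).2 hΓF hκ (Or.inl (le_max_right _ _))
  · refine le_iInf₂ fun k hk => ?_
    obtain ⟨Γ, -, hΓ⟩ := hk
    exact EReal.sub_le_of_le_add
      (CompEnt.compER_le_add_contTerm 𝓔 (hρ n hn) (Γ n) (hε n hn).2 (hΓ n hn))
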